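/- Let $k$ be a field of characteristic $\neq 2$. For binary quadratic forms $g,h$ over $k$ (homogeneous polynomials of degree $2$ in $s,t$) put $$M(s,t)=\begin{pmatrix} -st+t^2 & st & g(s,t)\\ st & s^2 & t^2\\ g(s,t) & t^2 & h(s,t)\end{pmatrix}.$$ Let $F\in k[T]$ be a separable monic polynomial of degree six with $F(0)=c^2$ for some $c\in k^*$. (a) There are exactly two pairs $(g,h)$ of binary quadratic forms over $k$ with $\det M(1,T)=-F(T)$; every such pair satisfies $g(1,0)=\pm c$, and each of the two values occurs for exactly one pair. (b) Let $(g,h)$ be the pair with $g(1,0)=c$. Then $(T_0\,T_1\,T_2)\,M(s,t)\,(T_0\,T_1\,T_2)^t=0$ defines a hypersurface $B_{F,c}$ of bidegree $(2,2)$ in $\mathbf P^1\times\mathbf P^2$ (that is, the form is nonzero and bihomogeneous of bidegree $(2,2)$). Write it as $Q_0s^2+Q_1st+Q_2t^2$ with ternary quadratic forms $Q_i$ in $T_0,T_1,T_2$. (i) The generic fibre of $\mathrm{pr}_1\colon B_{F,c}\to\mathbf P^1$ is a nonsingular conic. Over every field $K\supseteq k$, the fibre over each point of $\mathbf P^1(K)$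 is a conic, and it is degenerate (singular) exactly over the points $(1:t_0)$ with $t_0 \in K$ and $F(t_0)=0$. (ii) Let $l$ be the splitting field of $F(T^2)$ over $k$; it is Galois over $k$. There are exactly six points of $\mathbf P^1(l)$ with degenerate fibre, and each of these fibres is the union of two distinct lines defined over $l$. Over any extension field of $l$, the irreducible components of the degenerate fibres are exactly the base changes of those over $l$. There is a bijection, equivariant under $\mathrm{Gal}(l/k)$, from the set of roots of $F(T^2)$ in $l$ to the set of these irreducible components, and it sends a root $r$ to a component of the fibre over $(1:r^2)$. (iii) The form $Q_1^2-4Q_0Q_2$ is nonzero and homogeneous of degree four; let $C_{F,c}\subset\mathbf P^2$ be the quartic curve that it defines. Let $Z \subset\mathbf P^2$ be the closed subset $Q_0=Q_1=Q_2=0$ over which the fibre of $\mathrm{pr}_2\colon B_{F,c}\to\mathbf P^2$ is all of $\mathbf P^1$. Then $Z$ is finite and consists of singular points of $C_{F,c}$. Over $\mathbf P^2\setminus Z$, the projection $\mathrm{pr}_2$ is a double cover (finite locally free of rank two) branched in $C_{F,c}$: its discriminant is locally generated by $Q_1^2-4Q_0Q_2$, and a geometric fibre consists of one point over $C_{F,c}$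 and of two points elsewhere. If $C_{F,c}$ is nonsingular, then $\mathrm{pr}_2$ is a double cover of all of $\mathbf P^2$ branched in $C_{F,c}$. For generic $F$ the curve $C_{F,c}$ is nonsingular: there is a nonzero polynomial $\Delta\in k[a_0,\dots,a_5]$ such that, for every field $K\supseteq k$, every separable monic $F=T^6+a_5T^5+\dots+a_0\in K[T]$ with $\Delta(a_0,\dots,a_5)\neq0$ and every $c\in K^*$ with $c^2=a_0$, the curve $C_{F,c}$ over $K$ is nonsingular. -/

import Mathlib

namespace ConicBundle

open MvPolynomial

section Forms

variable {k : Type*} [CommRing k]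

/-- A form in `(s, t)` and `(T₀, T₁, T₂)` is written as a polynomial in the `Tᵢ` with coefficients in
`k[s, t]`, where `s = X 0` and `t = X 1`. -/
abbrev BiPoly (k : Type*) [CommRing k] : Type _ := MvPolynomial (Fin 3) (MvPolynomial (Fin 2) k)

/-- The symmetric matrix `M(s, t)` attached to two binary forms `g`, `h`. -/
noncomputable def conicMatrix (g h : MvPolynomial (Fin 2) k) :
    Matrix (Fin 3) (Fin 3) (MvPolynomial (Fin 2) k) :=
  !![-(X 0 * X 1) + X 1 ^ 2, X 0 * X 1, g;
     X 0 * X 1,              X 0 ^ 2,   X 1 ^ 2;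
     g,                      X 1 ^ 2,   h]

/-- `(g, h)` is a pair of binary quadratic forms with `det M(1, T) = -F(T)`. -/
def IsDetPair (F : Polynomial k) (g h : MvPolynomial (Fin 2) k) : Prop :=
  g.IsHomogeneous 2 ∧ h.IsHomogeneous 2 ∧
    ((conicMatrix g h).map (aeval ![1, Polynomial.X])).det = -F

/-- `(T₀ T₁ T₂) · M(s, t) · (T₀ T₁ T₂)ᵗ`, the form that defines the hypersurface `B` in `P¹ × P²`. -/
noncomputable def bundleForm (g h : MvPolynomial (Fin 2) k) : BiPoly k :=
  ∑ i, ∑ j, X i * C (conicMatrix g h i j) * X j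

/-- Bihomogeneous of degree `d` in `(s, t)` and of degree `e` in `(T₀, T₁, T₂)`. -/
def IsBihomogeneous (B : BiPoly k) (d e : ℕ) : Prop :=
  B.IsHomogeneous e ∧ ∀ m, (B.coeff m).IsHomogeneous d

variable {K : Type*} [CommRing K] [Algebra k K]

/-- Specialisation at `(s, t) = v`: the ternary form over `K` that defines the fibre of
`pr₁ : B → P¹` over the `K`-point `v`. -/
noncomputable def fibre₁ (B : BiPoly k) (v : Fin 2 → K) : MvPolynomial (Fin 3) K :=
  map (aeval v : MvPolynomial (Fin 2) k →ₐ[k] K).toRingHom B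

/-- Specialisation at `(T₀, T₁, T₂) = x`: the binary form over `K` that defines the fibre of
`pr₂ : B → P²` over the `K`-point `x`, as a closed subscheme of the projective line over `K`. -/
noncomputable def fibre₂ (B : BiPoly k) (x : Fin 3 → K) : MvPolynomial (Fin 2) K :=
  eval₂ (map (algebraMap k K)) (fun i => C (x i)) B

/-- The discriminant `q₁² - 4 q₀ q₂` of a binary quadratic form `q₀ s² + q₁ s t + q₂ t²`. -/
noncomputable def binaryDiscr (b : MvPolynomial (Fin 2) K) : K :=
  b.coeff (Finsupp.single 0 1 + Finsupp.single 1 1) ^ 2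
    - 4 * b.coeff (Finsupp.single 0 2) * b.coeff (Finsupp.single 1 2)

/-- The discriminant `Q₁² - 4 Q₀ Q₂` of `B = Q₀ s² + Q₁ s t + Q₂ t²`, where the `Qᵢ` are ternary
forms in `T₀, T₁, T₂`. -/
noncomputable def branchForm (B : BiPoly k) : MvPolynomial (Fin 3) k :=
  binaryDiscr (fibre₂ B (X : Fin 3 → MvPolynomial (Fin 3) k))

/-- Let `x` be an `R`-point of `P²` (for a local ring `R`, such as a local ring of `P²` or a field).
The pull-back of `pr₂ : B → P²` along `Spec R → P²` is the closed subscheme `b = 0` of the projective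
line over `R`, for `b = fibre₂ B x`. The predicate says that it is the spectrum of an `R`-algebra
that is free of rank two and has discriminant `D(x)` (up to units): for some coordinates `α`, `β`
the subscheme does not meet the section `α`, hence is contained in the affine line of the points
`u α + β`, and there its coordinate ring is `R[u] / (b (u α + β))`. -/
def IsDoubleCoverAt {R : Type*} [CommRing R] [Algebra k R]
    (B : BiPoly k) (D : MvPolynomial (Fin 3) k) (x : Fin 3 → R) : Prop :=
  ∃ α β : Fin 2 → R, IsUnit (α 0 * β 1 - α 1 * β 0) ∧ IsUnit (eval α (fibre₂ B x)) ∧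
    ∃ e : Module.Basis (Fin 2) R (AdjoinRoot (aeval
        (fun i => Polynomial.C (α i) * Polynomial.X + Polynomial.C (β i)) (fibre₂ B x))),
      Associated (Algebra.discr R e) (aeval x D)

end Forms

section Geometry

variable {k : Type*} [Field k]

/-- The plane curve `f = 0` over the field `k` has no geometric singular point. -/
def IsNonsingular (f : MvPolynomial (Fin 3) k) : Prop :=
  ∀ v : Fin 3 → AlgebraicClosure k, v ≠ 0 → aeval v f = 0 → ∃ i, aeval v (pderiv i f) ≠ 0

variable (K : Type*) [Field K] [Algebra k K]

/-- The `K`-points of the hypersurface `B = 0` in `P¹ × P²`. -/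
def points (B : BiPoly k) :
    Set (Projectivization K (Fin 2 → K) × Projectivization K (Fin 3 → K)) :=
  {z | eval z.2.rep (fibre₁ B z.1.rep) = 0}

/-- The `K`-points of `P¹` over which the fibre of `pr₁ : B → P¹` is singular. -/
def degeneratePoints (B : BiPoly k) : Set (Projectivization K (Fin 2 → K)) :=
  {p | ¬ IsNonsingular (fibre₁ B p.rep)}

/-- The irreducible components, over `K`, of the singular fibres of `pr₁ : B → P¹` over `K`-points:
pairs `(p, a)` of such a point `p` and an irreducible factor `a`, up to units, of the ternary form
that defines the fibre over `p`. -/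
def degenerateComponents (B : BiPoly k) :
    Set (Projectivization K (Fin 2 → K) × Associates (MvPolynomial (Fin 3) K)) :=
  {z | z.1 ∈ degeneratePoints K B ∧ Irreducible z.2 ∧ z.2 ∣ Associates.mk (fibre₁ B z.1.rep)}

/-- The `K`-points of `P²` over which the fibre of `pr₂ : B → P²` is the whole projective line. -/
def fullFibrePoints (B : BiPoly k) : Set (Projectivization K (Fin 3 → K)) :=
  {x | fibre₂ B x.rep = 0}

end Geometry

section BaseChange

variable {K L : Type*} [Field K] [Field L]

/-- A homomorphism of fields applied to the coordinates of a vector. -/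
def coordMap (φ : K →+* L) (n : ℕ) : (Fin n → K) →ₛₗ[φ] (Fin n → L) where
  toFun v i := φ (v i)
  map_add' v w := funext fun i => map_add φ (v i) (w i)
  map_smul' a v := funext fun i => map_mul φ a (v i)

theorem coordMap_injective (φ : K →+* L) (n : ℕ) : Function.Injective (coordMap φ n) :=
  fun _ _ h => funext fun i => φ.injective (congrFun h i)

/-- A homomorphism of fields applied to the coefficients of a ternary form, up to units. -/
noncomputable def coeffMap (φ : K →+* L) :
    Associates (MvPolynomial (Fin 3) K) → Associates (MvPolynomial (Fin 3) L) :=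
  Quotient.map (map φ) fun a _ ⟨u, hu⟩ =>
    ⟨Units.map (map φ : MvPolynomial (Fin 3) K →+* MvPolynomial (Fin 3) L).toMonoidHom u,
      (map_mul (map φ) a u).symm.trans (congrArg (map φ) hu)⟩

/-- The effect of a homomorphism of fields (a base change, or a Galois automorphism) on pairs of a
point of `P¹` and a plane curve. -/
noncomputable def transport (φ : K →+* L)
    (z : Projectivization K (Fin 2 → K) × Associates (MvPolynomial (Fin 3) K)) :
    Projectivization L (Fin 2 → L) × Associates (MvPolynomial (Fin 3) L) :=
  (Projectivization.map (coordMap φ 2) (coordMap_injective φ 2) z.1,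
    coeffMap φ z.2)

/-- The point `(1 : a)` of the projective line. -/
def affinePoint (a : K) : Projectivization K (Fin 2 → K) :=
  Projectivization.mk K ![1, a] (fun h => one_ne_zero (congrFun h 0))

end BaseChange

end ConicBundle

/-! Everything comes from completing the square in `T₁`. At `(1 : t)` the fibre of `pr₁` is `(T₁ + t
T₀ + t² T₂)² - (t T₀² + 2 (t³ - g) T₀ T₂ + (t⁴ - h) T₂²)`, and a quarter of the discriminant of the
subtracted binary form is `(t³ - g)² - t⁵ + t h = -det M(1, t)`. Comparing coefficients with `F`
gives a triangular system: `T⁵` and `T⁴` determine two coefficients of `g`, the constant term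
determines `g(1, 0)` up to sign, and `T`, `T²`, `T³` then determine `h`
(`isDetPair_iff_eq_detPair`).

If `F(t) = 0`, the subtracted form is `t` times the square of a linear form. A square root `r` of
`t` therefore splits the fibre into two lines, interchanged by `r ↦ -r`
(`fibre₁_eq_mul_componentForm`). Each line is given by one formula in `r` over `k`, which yields the
Galois equivariance and the compatibility with base change (`transport_component`,
`bijOn_component`).

The fibre of `pr₂` is the zero scheme of the binary form `Q₀ s² + Q₁ s t + Q₂ t²`. Where some `Qᵢ`
is a unit, this is a free quadratic algebra with the expected discriminant (`isDoubleCoverAt`). At a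
singular point `v` of the branch curve outside `Z`, this form has a double root `(s : t)` and `M(s,
t) v = 0`. The point `(0 : 1)` is impossible, and at `(1 : t)` both `F` and `F'` vanish, against
separability (`isNonsingular_branchForm`). So the branch curve is nonsingular as soon as `Z` is
geometrically empty.

Elimination of `T₁` by `Q₂ = 0` turns `Z` into the common roots of a quartic and a cubic. Their
resultant is a polynomial in `c` and the coefficients of `F`; its norm under `c ↦ -c` is a
polynomial in `c² = a₀` and serves as `Δ`. One specialisation shows that it is nonzero. -/

namespace ConicBundle

open MvPolynomial

/-! ### Binary quadratic forms and their coefficients. -/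

section BinaryForms

variable {R : Type*} [CommRing R]

/-- The binary quadratic form `a s² + b s t + c t²`. -/
noncomputable def binForm (a b c : R) : MvPolynomial (Fin 2) R :=
  C a * X 0 ^ 2 + C b * (X 0 * X 1) + C c * X 1 ^ 2

theorem isHomogeneous_binForm (a b c : R) : (binForm a b c).IsHomogeneous 2 := by
  refine ((IsHomogeneous.C_mul ?_ _).add (IsHomogeneous.C_mul ?_ _)).add (IsHomogeneous.C_mul ?_ _)
  · exact (isHomogeneous_X R 0).pow 2
  · exact (isHomogeneous_X R 0).mul (isHomogeneous_X R 1)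
  · exact (isHomogeneous_X R 1).pow 2

theorem binForm_eq_monomial (a b c : R) : binForm a b c =
    monomial (Finsupp.single 0 2) a + monomial (Finsupp.single 0 1 + Finsupp.single 1 1) b +
      monomial (Finsupp.single 1 2) c := by
  have h : (X 0 * X 1 : MvPolynomial (Fin 2) R)
      = monomial (Finsupp.single 0 1 + Finsupp.single 1 1) 1 := by
    rw [X, X, monomial_mul, one_mul]
  rw [binForm, h, C_mul_X_pow_eq_monomial, C_mul_X_pow_eq_monomial, C_mul_monomial, mul_one]

theorem single_sq_ne_mixed (i : Fin 2) :
    (Finsupp.single i 2 : Fin 2 →₀ ℕ) ≠ Finsupp.single 0 1 + Finsupp.single 1 1 := by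
  intro h
  have := DFunLike.congr_fun h i
  fin_cases i <;> simp at this

theorem single_zero_sq_ne_single_one_sq :
    (Finsupp.single 0 2 : Fin 2 →₀ ℕ) ≠ Finsupp.single 1 2 := by
  intro h
  have := DFunLike.congr_fun h 0
  simp at this

@[simp] theorem coeff_binForm_zero (a b c : R) :
    (binForm a b c).coeff (Finsupp.single 0 2) = a := by
  simp [binForm_eq_monomial, coeff_monomial, (single_sq_ne_mixed 0).symm,
    single_zero_sq_ne_single_one_sq.symm]

@[simp] theorem coeff_binForm_mixed (a b c : R) :
    (binForm a b c).coeff (Finsupp.single 0 1 + Finsupp.single 1 1) = b := by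
  simp [binForm_eq_monomial, coeff_monomial, single_sq_ne_mixed]

@[simp] theorem coeff_binForm_one (a b c : R) :
    (binForm a b c).coeff (Finsupp.single 1 2) = c := by
  simp [binForm_eq_monomial, coeff_monomial, (single_sq_ne_mixed 1).symm,
    single_zero_sq_ne_single_one_sq]

theorem eq_of_degree_eq_two (m : Fin 2 →₀ ℕ) (hm : m.degree = 2) :
    m = Finsupp.single 0 2 ∨ m = Finsupp.single 0 1 + Finsupp.single 1 1 ∨
      m = Finsupp.single 1 2 := by
  have h : m 0 + m 1 = 2 := by simpa [Finsupp.degree_eq_sum] using hm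
  have h0 : m 0 ≤ 2 := by omega
  interval_cases h' : m 0
  · right; right; ext i; fin_cases i <;> simp <;> omega
  · right; left; ext i; fin_cases i <;> simp <;> omega
  · left; ext i; fin_cases i <;> simp <;> omega

theorem eq_binForm_of_isHomogeneous {g : MvPolynomial (Fin 2) R} (hg : g.IsHomogeneous 2) :
    g = binForm (g.coeff (Finsupp.single 0 2))
      (g.coeff (Finsupp.single 0 1 + Finsupp.single 1 1)) (g.coeff (Finsupp.single 1 2)) := by
  ext m
  by_cases hm : m.degree = 2
  · rcases eq_of_degree_eq_two m hm with rfl | rfl | rfl <;> simp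
  · rw [hg.coeff_eq_zero hm, (isHomogeneous_binForm _ _ _).coeff_eq_zero hm]

theorem binForm_injective {a b c a' b' c' : R} :
    binForm a b c = binForm a' b' c' ↔ a = a' ∧ b = b' ∧ c = c' := by
  refine ⟨fun h => ?_, fun ⟨h₁, h₂, h₃⟩ => by rw [h₁, h₂, h₃]⟩
  refine ⟨?_, ?_, ?_⟩
  · simpa using congrArg (coeff (Finsupp.single 0 2)) h
  · have := congrArg (coeff (Finsupp.single 0 1 + Finsupp.single 1 1)) h
    rwa [coeff_binForm_mixed, coeff_binForm_mixed] at this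
  · simpa using congrArg (coeff (Finsupp.single 1 2)) h

theorem aeval_binForm {S : Type*} [CommRing S] [Algebra R S] (a b c : R) (v : Fin 2 → S) :
    aeval v (binForm a b c) = algebraMap R S a * v 0 ^ 2 + algebraMap R S b * (v 0 * v 1)
      + algebraMap R S c * v 1 ^ 2 := by
  simp [binForm]

theorem eval_binForm (a b c : R) (v : Fin 2 → R) :
    eval v (binForm a b c) = a * v 0 ^ 2 + b * (v 0 * v 1) + c * v 1 ^ 2 := by
  simp [binForm]

end BinaryForms

/-! ### The determinant of `M` and the pairs `(g, h)`. -/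

section Determinant

variable {k : Type*} [CommRing k]

/-- At `v = (1, t)` the bracket is a quarter of the discriminant of the binary form in `T₀`, `T₂`
that is left after completing the square in `T₁`. -/
theorem det_conicMatrix_map {S : Type*} [CommRing S] [Algebra k S] (g h : MvPolynomial (Fin 2) k)
    (v : Fin 2 → S) : ((conicMatrix g h).map (aeval v)).det =
      -((v 1 ^ 3 - v 0 * aeval v g) ^ 2 - v 0 * v 1 ^ 5 + v 0 ^ 3 * v 1 * aeval v h) := by
  rw [Matrix.det_fin_three]
  simp [conicMatrix]
  ring

theorem isDetPair_iff (F : Polynomial k) (g h : MvPolynomial (Fin 2) k) :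
    IsDetPair F g h ↔ g.IsHomogeneous 2 ∧ h.IsHomogeneous 2 ∧
      F = (Polynomial.X ^ 3 - aeval ![1, Polynomial.X] g) ^ 2 - Polynomial.X ^ 5 +
        Polynomial.X * aeval ![1, Polynomial.X] h := by
  rw [IsDetPair, det_conicMatrix_map, neg_inj, eq_comm (b := F)]
  simp

/-- The coefficients of `F` in terms of those of `g` and `h`. -/
theorem isDetPair_binForm_iff {F : Polynomial k} (hF : F.Monic) (hd : F.natDegree = 6)
    (a b c a' b' c' : k) : IsDetPair F (binForm a b c) (binForm a' b' c') ↔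
      F.coeff 0 = a ^ 2 ∧ F.coeff 1 = 2 * a * b + a' ∧ F.coeff 2 = b ^ 2 + 2 * a * c + b' ∧
      F.coeff 3 = 2 * b * c - 2 * a + c' ∧ F.coeff 4 = c ^ 2 - 2 * b ∧
      F.coeff 5 = -(2 * c) - 1 := by
  have h6 : F.coeff 6 = 1 := by rw [← hd]; exact hF
  have key : (Polynomial.X ^ 3 - aeval ![1, Polynomial.X] (binForm a b c)) ^ 2 -
      (Polynomial.X : Polynomial k) ^ 5 + Polynomial.X * aeval ![1, Polynomial.X]
        (binForm a' b' c') = ∑ i ∈ Finset.range 7, Polynomial.C ((![a ^ 2, 2 * a * b + a',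
        b ^ 2 + 2 * a * c + b', 2 * b * c - 2 * a + c', c ^ 2 - 2 * b, -(2 * c) - 1, 1] :
        Fin 7 → k) (Fin.ofNat 7 i)) * Polynomial.X ^ i := by
    simp [Finset.sum_range_succ, aeval_binForm, Polynomial.algebraMap_eq, Fin.ofNat]
    rw [show (Polynomial.C (2 : k)) = 2 from map_ofNat Polynomial.C 2]
    ring
  rw [isDetPair_iff, key]
  simp only [isHomogeneous_binForm, true_and]
  constructor
  · intro h
    have hc : ∀ i < 7, F.coeff i = (![a ^ 2, 2 * a * b + a', b ^ 2 + 2 * a * c + b',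
        2 * b * c - 2 * a + c', c ^ 2 - 2 * b, -(2 * c) - 1, 1] : Fin 7 → k) (Fin.ofNat 7 i) :=
      fun i hi => by
        rw [h, Polynomial.finsetSum_coeff]
        simp only [Polynomial.coeff_C_mul_X_pow]
        rw [Finset.sum_ite_eq, if_pos (Finset.mem_range.mpr hi)]
    exact ⟨hc 0 (by norm_num), hc 1 (by norm_num), hc 2 (by norm_num), hc 3 (by norm_num),
      hc 4 (by norm_num), hc 5 (by norm_num)⟩
  · rintro ⟨h0, h1, h2, h3, h4, h5⟩
    conv_lhs => rw [F.as_sum_range_C_mul_X_pow, hd]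
    refine Finset.sum_congr rfl fun i hi => ?_
    rw [Finset.mem_range] at hi
    interval_cases i <;> simp [Fin.ofNat, *]

end Determinant

section Pairs

variable {k : Type*} [Field k]

/-- The pair `(g, h)` with `det M(1, T) = -F(T)` and `g(1, 0) = c`. -/
noncomputable def detPair (F : Polynomial k) (c : k) :
    MvPolynomial (Fin 2) k × MvPolynomial (Fin 2) k :=
  let g₂ := -(F.coeff 5 + 1) / 2
  let g₁ := (g₂ ^ 2 - F.coeff 4) / 2
  (binForm c g₁ g₂, binForm (F.coeff 1 - 2 * c * g₁) (F.coeff 2 - g₁ ^ 2 - 2 * c * g₂)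
    (F.coeff 3 - 2 * g₁ * g₂ + 2 * c))

theorem eval_detPair (F : Polynomial k) (c : k) : eval ![1, 0] (detPair F c).1 = c := by
  simp [detPair, eval_binForm]

/-- The system of coefficient equations is triangular: `F.coeff 5` gives `g₂`, then `F.coeff 4`
gives `g₁`, and once `g(1, 0)` is chosen as a square root of `F.coeff 0`, the three remaining
equations are solved for `h`. The only division is by 2. -/
theorem isDetPair_iff_eq_detPair (h2 : (2 : k) ≠ 0) {F : Polynomial k} (hF : F.Monic)
    (hd : F.natDegree = 6) (g h : MvPolynomial (Fin 2) k) :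
    IsDetPair F g h ↔ ∃ c, F.coeff 0 = c ^ 2 ∧ (g, h) = detPair F c := by
  constructor
  · intro H
    have hg := eq_binForm_of_isHomogeneous H.1
    have hh := eq_binForm_of_isHomogeneous H.2.1
    generalize g.coeff (Finsupp.single 0 2) = a at hg
    generalize g.coeff (Finsupp.single 0 1 + Finsupp.single 1 1) = b at hg
    generalize g.coeff (Finsupp.single 1 2) = c at hg
    generalize h.coeff (Finsupp.single 0 2) = a' at hh
    generalize h.coeff (Finsupp.single 0 1 + Finsupp.single 1 1) = b' at hh
    generalize h.coeff (Finsupp.single 1 2) = c' at hh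
    subst hg hh
    obtain ⟨e0, e1, e2, e3, e4, e5⟩ := (isDetPair_binForm_iff hF hd _ _ _ _ _ _).1 H
    refine ⟨a, e0, ?_⟩
    have hc : -(F.coeff 5 + 1) / 2 = c := by rw [e5]; field_simp; ring
    have hb : (c ^ 2 - F.coeff 4) / 2 = b := by rw [e4]; field_simp; ring
    simp only [detPair, Prod.mk.injEq, binForm_injective, hc, hb, true_and]
    exact ⟨by rw [e1]; ring, by rw [e2]; ring, by rw [e3]; ring⟩
  · rintro ⟨c, hc, H⟩
    rw [detPair, Prod.mk.injEq] at H
    obtain ⟨rfl, rfl⟩ := H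
    rw [isDetPair_binForm_iff hF hd]
    refine ⟨hc, by ring, by ring, by ring, ?_, ?_⟩
    · field_simp
      ring
    · field_simp
      ring

theorem detPair_claims (h2 : (2 : k) ≠ 0) {F : Polynomial k} (hF : F.Monic)
    (hd : F.natDegree = 6) {c : k} (hc : c ≠ 0) (hFc : F.coeff 0 = c ^ 2) :
    {p : MvPolynomial (Fin 2) k × MvPolynomial (Fin 2) k | IsDetPair F p.1 p.2}.ncard = 2 ∧
      (∀ g h, IsDetPair F g h → eval ![1, 0] g = c ∨ eval ![1, 0] g = -c) ∧
      (∃! p : MvPolynomial (Fin 2) k × MvPolynomial (Fin 2) k,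
        IsDetPair F p.1 p.2 ∧ eval ![1, 0] p.1 = c) ∧
      (∃! p : MvPolynomial (Fin 2) k × MvPolynomial (Fin 2) k,
        IsDetPair F p.1 p.2 ∧ eval ![1, 0] p.1 = -c) := by
  have hne : c ≠ -c := fun h => hc <| by
    have : 2 * c = 0 := by linear_combination h
    exact (mul_eq_zero.1 this).resolve_left h2
  have key : ∀ p : MvPolynomial (Fin 2) k × MvPolynomial (Fin 2) k,
      IsDetPair F p.1 p.2 ↔ p = detPair F c ∨ p = detPair F (-c) := by
    rintro ⟨g, h⟩
    rw [isDetPair_iff_eq_detPair h2 hF hd, hFc]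
    constructor
    · rintro ⟨d, hd, e⟩
      rcases sq_eq_sq_iff_eq_or_eq_neg.1 hd with h | h
      · exact Or.inl (by rw [e, h])
      · exact Or.inr (by rw [e, h, neg_neg])
    · rintro (e | e)
      exacts [⟨c, rfl, e⟩, ⟨-c, by ring, e⟩]
  have hp : detPair F c ≠ detPair F (-c) := fun h => hne <| by
    rw [← eval_detPair F (-c), ← h, eval_detPair]
  refine ⟨?_, fun g h H => ?_, ⟨detPair F c, ?_, ?_⟩, ⟨detPair F (-c), ?_, ?_⟩⟩
  · exact (congrArg Set.ncard (Set.ext key)).trans (Set.ncard_pair hp)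
  · rcases (key (g, h)).1 H with e | e
    · exact Or.inl ((congrArg (fun p => eval ![1, 0] p.1) e).trans (eval_detPair F c))
    · exact Or.inr ((congrArg (fun p => eval ![1, 0] p.1) e).trans (eval_detPair F (-c)))
  · exact ⟨(key _).2 (Or.inl rfl), eval_detPair F c⟩
  · rintro p ⟨hp, he⟩
    rcases (key p).1 hp with e | e
    · exact e
    · rw [e, eval_detPair] at he
      exact absurd he.symm hne
  · exact ⟨(key _).2 (Or.inr rfl), eval_detPair F (-c)⟩
  · rintro p ⟨hp, he⟩
    rcases (key p).1 hp with e | e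
    · rw [e, eval_detPair] at he
      exact absurd he hne
    · exact e

end Pairs

/-! ### Ternary quadratic forms and bihomogeneity. -/

section TernaryForms

variable {R : Type*} [CommRing R]

/-- The ternary quadratic form `(T₀ T₁ T₂) · M · (T₀ T₁ T₂)ᵗ`. -/
noncomputable def quadForm (M : Matrix (Fin 3) (Fin 3) R) : MvPolynomial (Fin 3) R :=
  ∑ i, ∑ j, X i * C (M i j) * X j

theorem isHomogeneous_quadForm (M : Matrix (Fin 3) (Fin 3) R) : (quadForm M).IsHomogeneous 2 :=
  IsHomogeneous.sum _ _ _ fun i _ => IsHomogeneous.sum _ _ _ fun j _ =>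
    ((isHomogeneous_X R i).mul (isHomogeneous_C _ (M i j))).mul (isHomogeneous_X R j)

theorem map_quadForm {S : Type*} [CommRing S] (φ : R →+* S) (M : Matrix (Fin 3) (Fin 3) R) :
    map φ (quadForm M) = quadForm (M.map φ) := by
  simp [quadForm]

theorem quadForm_smul (a : R) (M : Matrix (Fin 3) (Fin 3) R) :
    quadForm (a • M) = C a * quadForm M := by
  simp only [quadForm, Finset.mul_sum, Matrix.smul_apply, smul_eq_mul, map_mul]
  refine Finset.sum_congr rfl fun i _ => Finset.sum_congr rfl fun j _ => by ring

theorem aeval_quadForm {S : Type*} [CommRing S] [Algebra R S] (M : Matrix (Fin 3) (Fin 3) R)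
    (v : Fin 3 → S) :
    aeval v (quadForm M) = ∑ i, v i * (M.map (algebraMap R S)).mulVec v i := by
  simp only [quadForm, map_sum, map_mul, aeval_X, aeval_C, Matrix.mulVec, dotProduct,
    Matrix.map_apply, Finset.mul_sum, mul_assoc]

theorem aeval_pderiv_quadForm {S : Type*} [CommRing S] [Algebra R S]
    {M : Matrix (Fin 3) (Fin 3) R} (hM : M.IsSymm) (v : Fin 3 → S) (i : Fin 3) :
    aeval v (pderiv i (quadForm M)) = 2 * (M.map (algebraMap R S)).mulVec v i := by
  have h01 : M 1 0 = M 0 1 := hM.apply 0 1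
  have h02 : M 2 0 = M 0 2 := hM.apply 0 2
  have h12 : M 2 1 = M 1 2 := hM.apply 1 2
  fin_cases i <;>
  · simp [quadForm, Fin.sum_univ_three, Matrix.mulVec, dotProduct, pderiv_X,
      h01, h02, h12]
    ring

theorem isSymm_conicMatrix (g h : MvPolynomial (Fin 2) R) : (conicMatrix g h).IsSymm := by
  ext i j
  fin_cases i <;> fin_cases j <;> simp [conicMatrix]

theorem isHomogeneous_conicMatrix {g h : MvPolynomial (Fin 2) R} (hg : g.IsHomogeneous 2)
    (hh : h.IsHomogeneous 2) (i j : Fin 3) : (conicMatrix g h i j).IsHomogeneous 2 := by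
  have h01 : (X 0 * X 1 : MvPolynomial (Fin 2) R).IsHomogeneous 2 :=
    (isHomogeneous_X R 0).mul (isHomogeneous_X R 1)
  have hsq : ∀ i : Fin 2, (X i ^ 2 : MvPolynomial (Fin 2) R).IsHomogeneous 2 :=
    fun i => (isHomogeneous_X R i).pow 2
  fin_cases i <;> fin_cases j <;> simp [conicMatrix, hg, hh, h01, hsq, h01.neg.add (hsq 1)]

theorem isBihomogeneous_bundleForm {g h : MvPolynomial (Fin 2) R} (hg : g.IsHomogeneous 2)
    (hh : h.IsHomogeneous 2) : IsBihomogeneous (bundleForm g h) 2 2 := by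
  refine ⟨isHomogeneous_quadForm _, fun m => ?_⟩
  rw [bundleForm, coeff_sum]
  refine IsHomogeneous.sum _ _ _ fun i _ => ?_
  rw [coeff_sum]
  refine IsHomogeneous.sum _ _ _ fun j _ => ?_
  rw [mul_comm (X i) (C _), mul_assoc, coeff_C_mul, X, X, monomial_mul, coeff_monomial]
  split_ifs
  · simpa using isHomogeneous_conicMatrix hg hh i j
  · simpa using isHomogeneous_zero _ _ _

end TernaryForms

/-! ### Nonsingular conics and determinants. -/

section Nonsingular

theorem two_ne_zero_of_algebra (k K : Type*) [Field k] [Field K] [Algebra k K]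
    (h2 : (2 : k) ≠ 0) : (2 : K) ≠ 0 := by
  rw [← map_ofNat (algebraMap k K) 2]
  exact (map_ne_zero (algebraMap k K)).2 h2

variable {K : Type*} [Field K]

/-- The gradient of the form at `v` is `2 M v`, so the singular points are the kernel vectors of `M`
over the algebraic closure; these lie on the conic automatically. -/
theorem isNonsingular_quadForm_iff (h2 : (2 : K) ≠ 0) {M : Matrix (Fin 3) (Fin 3) K}
    (hM : M.IsSymm) : IsNonsingular (quadForm M) ↔ M.det ≠ 0 := by
  have h2' := two_ne_zero_of_algebra K (AlgebraicClosure K) h2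
  have hdet : (M.map (algebraMap K (AlgebraicClosure K))).det = algebraMap K _ M.det :=
    ((algebraMap K (AlgebraicClosure K)).map_det M).symm
  constructor
  · intro H hd
    rw [hd, map_zero] at hdet
    obtain ⟨v, hv, hMv⟩ := Matrix.exists_mulVec_eq_zero_iff.2 hdet
    obtain ⟨i, hi⟩ := H v hv (by rw [aeval_quadForm, hMv]; simp)
    rw [aeval_pderiv_quadForm hM, hMv] at hi
    simp at hi
  · intro hd v hv _
    by_contra! H
    have hMv : (M.map (algebraMap K (AlgebraicClosure K))).mulVec v = 0 := _root_.funext fun i => by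
      have := H i
      rw [aeval_pderiv_quadForm hM] at this
      exact (mul_eq_zero.1 this).resolve_left h2'
    have := Matrix.exists_mulVec_eq_zero_iff.1 ⟨v, hv, hMv⟩
    rw [hdet, map_eq_zero] at this
    exact hd this

end Nonsingular

/-! ### Fibres of the first projection. -/

section Fibres

variable {k : Type*} [CommRing k] {K : Type*} [CommRing K] [Algebra k K]

/-- The matrix of the fibre of `pr₁` over `v`. -/
noncomputable def fibreMatrix (g h : MvPolynomial (Fin 2) k) (v : Fin 2 → K) :
    Matrix (Fin 3) (Fin 3) K :=
  (conicMatrix g h).map (aeval v)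

theorem fibre₁_bundleForm (g h : MvPolynomial (Fin 2) k) (v : Fin 2 → K) :
    fibre₁ (bundleForm g h) v = quadForm (fibreMatrix g h v) :=
  map_quadForm _ _

theorem isSymm_fibreMatrix (g h : MvPolynomial (Fin 2) k) (v : Fin 2 → K) :
    (fibreMatrix g h v).IsSymm :=
  (isSymm_conicMatrix g h).map _

theorem fibreMatrix_smul {g h : MvPolynomial (Fin 2) k} (hg : g.IsHomogeneous 2)
    (hh : h.IsHomogeneous 2) (a : K) (v : Fin 2 → K) :
    fibreMatrix g h (a • v) = a ^ 2 • fibreMatrix g h v := by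
  have key : ∀ f : MvPolynomial (Fin 2) k, f.IsHomogeneous 2 →
      aeval (a • v) f = a ^ 2 * aeval v f := fun f hf => by
    rw [eq_binForm_of_isHomogeneous hf]
    simp only [aeval_binForm, Pi.smul_apply, smul_eq_mul]
    ring
  ext i j
  exact key _ (isHomogeneous_conicMatrix hg hh i j)

theorem fibre₁_smul {g h : MvPolynomial (Fin 2) k} (hg : g.IsHomogeneous 2)
    (hh : h.IsHomogeneous 2) (a : K) (v : Fin 2 → K) :
    fibre₁ (bundleForm g h) (a • v) = C (a ^ 2) * fibre₁ (bundleForm g h) v := by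
  rw [fibre₁_bundleForm, fibre₁_bundleForm, fibreMatrix_smul hg hh, quadForm_smul]

theorem aeval_eq_of_isDetPair {F : Polynomial k} {g h : MvPolynomial (Fin 2) k}
    (H : IsDetPair F g h) (t : K) : Polynomial.aeval t F =
      (t ^ 3 - aeval ![1, t] g) ^ 2 - t ^ 5 + t * aeval ![1, t] h := by
  have key : ∀ f : MvPolynomial (Fin 2) k,
      Polynomial.aeval t (aeval ![1, Polynomial.X] f : Polynomial k) = aeval ![1, t] f := fun f => by
    refine (map_aeval _ _ f).trans ?_
    rw [aeval_def, ← coe_eval₂Hom]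
    congr 2
    · ext a
      simp
    · funext i
      fin_cases i <;> simp
  rw [((isDetPair_iff F g h).1 H).2.2]
  simp [key]

theorem det_fibreMatrix {F : Polynomial k} {g h : MvPolynomial (Fin 2) k}
    (H : IsDetPair F g h) (t : K) : (fibreMatrix g h ![1, t]).det = -Polynomial.aeval t F := by
  rw [fibreMatrix, det_conicMatrix_map, aeval_eq_of_isDetPair H]
  simp

theorem det_fibreMatrix_of_zero (g h : MvPolynomial (Fin 2) k) {v : Fin 2 → K} (hv : v 0 = 0) :
    (fibreMatrix g h v).det = -v 1 ^ 6 := by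
  rw [fibreMatrix, det_conicMatrix_map, hv]
  ring

end Fibres

/-! ### The points with degenerate fibre. -/

section DegeneratePoints

variable {k : Type*} [Field k] {F : Polynomial k} {g h : MvPolynomial (Fin 2) k}
variable {K : Type*} [Field K] [Algebra k K]

theorem affinePoint_injective : Function.Injective (affinePoint : K → _) := by
  intro a b hab
  obtain ⟨c, hc⟩ := (Projectivization.mk_eq_mk_iff' K _ _ _ _).1 hab
  have h0 : c = 1 := by simpa using congrFun hc 0
  have h1 : c * b = a := by simpa using congrFun hc 1
  rw [← h1, h0, one_mul]

theorem exists_rep_affinePoint (t : K) : ∃ a : K, a ≠ 0 ∧ (affinePoint t).rep = a • ![1, t] := by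
  obtain ⟨a, ha⟩ := Projectivization.exists_smul_eq_mk_rep K ![1, t]
    (fun h => one_ne_zero (congrFun h 0))
  exact ⟨a, a.ne_zero, ha.symm⟩

theorem eq_affinePoint (p : Projectivization K (Fin 2 → K)) (hp : p.rep 0 ≠ 0) :
    p = affinePoint (p.rep 1 / p.rep 0) := by
  conv_lhs => rw [← p.mk_rep]
  rw [affinePoint, Projectivization.mk_eq_mk_iff']
  refine ⟨p.rep 0, _root_.funext fun i => ?_⟩
  fin_cases i
  · simp
  · simp [mul_div_cancel₀ _ hp]

theorem fibre₁_ne_zero (h2 : (2 : k) ≠ 0) (g h : MvPolynomial (Fin 2) k) {v : Fin 2 → K}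
    (hv : v ≠ 0) : fibre₁ (bundleForm g h) v ≠ 0 := by
  have h2' := two_ne_zero_of_algebra k K h2
  rw [fibre₁_bundleForm]
  intro H
  -- The three evaluations isolate the coefficient `s²` of `T₁²` and, by polarisation, the
  -- coefficient `2 t²` of `T₁ T₂`; these do not involve `g` and `h`.
  have e := fun w : Fin 3 → K => congrArg (aeval w) H
  simp only [aeval_quadForm, Fin.sum_univ_three, Matrix.mulVec, dotProduct, fibreMatrix,
    conicMatrix] at e
  have e1 := e ![0, 1, 0]
  have e2 := e ![0, 1, 1]
  have e3 := e ![0, 0, 1]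
  simp at e1 e2 e3
  rw [e1, e3] at e2
  apply hv
  ext i
  fin_cases i
  · exact e1
  · have : 2 * v 1 ^ 2 = 0 := by linear_combination e2
    simpa [h2'] using this

/-- The determinant is `-F(t)` at `(1, t)` and nonzero at infinity. Rescaling a representative
multiplies the matrix by a nonzero square, so the choice of `rep` is harmless. -/
theorem degeneratePoints_eq (h2 : (2 : k) ≠ 0) (hF : F ≠ 0) (H : IsDetPair F g h) :
    degeneratePoints K (bundleForm g h) = affinePoint '' F.rootSet K := by
  have h2' := two_ne_zero_of_algebra k K h2
  have hd : ∀ t : K, (fibreMatrix g h (affinePoint t).rep).det = 0 ↔ Polynomial.aeval t F = 0 := by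
    intro t
    obtain ⟨a, ha, e⟩ := exists_rep_affinePoint t
    rw [e, fibreMatrix_smul H.1 H.2.1, Matrix.det_smul, det_fibreMatrix H]
    simp [ha]
  ext p
  change ¬ IsNonsingular (fibre₁ (bundleForm g h) p.rep) ↔ _
  rw [fibre₁_bundleForm,
    isNonsingular_quadForm_iff h2' (isSymm_fibreMatrix _ _ _), not_not]
  constructor
  · intro hp
    by_cases h0 : p.rep 0 = 0
    · rw [det_fibreMatrix_of_zero g h h0] at hp
      have h1 : p.rep 1 = 0 := by simpa using hp
      exact absurd (_root_.funext fun i => by fin_cases i <;> assumption) p.rep_nonzero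
    · have e := eq_affinePoint p h0
      rw [e, hd] at hp
      exact ⟨_, Polynomial.mem_rootSet.2 ⟨hF, hp⟩, e.symm⟩
  · rintro ⟨t, ht, rfl⟩
    exact (hd t).2 (Polynomial.mem_rootSet.1 ht).2

theorem isNonsingular_genericFibre (h2 : (2 : k) ≠ 0) (hF : F ≠ 0) (H : IsDetPair F g h) :
    IsNonsingular (fibre₁ (bundleForm g h) ![(1 : RatFunc k), RatFunc.X]) := by
  rw [fibre₁_bundleForm, isNonsingular_quadForm_iff (two_ne_zero_of_algebra k _ h2)
    (isSymm_fibreMatrix _ _ _), det_fibreMatrix H, neg_ne_zero, RatFunc.aeval_X_left_eq_algebraMap]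
  exact (map_ne_zero_iff _ (RatFunc.algebraMap_injective k)).2 hF

end DegeneratePoints

/-! ### Lines and the components of the degenerate fibres. -/

section Lines

variable {L : Type*} [Field L]

/-- The linear form `b T₀ + T₁ + d T₂`. -/
noncomputable def linForm (b d : L) : MvPolynomial (Fin 3) L := C b * X 0 + X 1 + C d * X 2

theorem isHomogeneous_linForm (b d : L) : (linForm b d).IsHomogeneous 1 :=
  ((IsHomogeneous.C_mul (isHomogeneous_X L 0) b).add (isHomogeneous_X L 1)).add
    (IsHomogeneous.C_mul (isHomogeneous_X L 2) d)

theorem coeff_linForm (b d : L) : (linForm b d).coeff (Finsupp.single 1 1) = 1 := by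
  simp [linForm, coeff_C_mul, coeff_X, Finsupp.single_left_inj]

theorem irreducible_linForm (b d : L) : Irreducible (linForm b d) := by
  refine irreducible_of_totalDegree_eq_one ?_ fun x hx => ?_
  · refine (isHomogeneous_linForm b d).totalDegree fun h => ?_
    simpa [h] using coeff_linForm b d
  · exact isUnit_of_dvd_one (coeff_linForm b d ▸ hx _)

theorem eq_of_linForm_dvd {b d b' d' : L} (H : linForm b d ∣ linForm b' d') : b = b' := by
  obtain ⟨q, hq⟩ := H
  -- The point `(1 : -b : 0)` lies on the first line, hence on the second.
  have := congrArg (eval ![1, -b, 0]) hq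
  simp [linForm] at this
  linear_combination -this

theorem map_linForm {L' : Type*} [Field L'] (φ : L →+* L') (b d : L) :
    map φ (linForm b d) = linForm (φ b) (φ d) := by
  simp [linForm]

end Lines

section Components

variable {k : Type*} [Field k] {F : Polynomial k} {g h : MvPolynomial (Fin 2) k}
variable {L : Type*} [Field L] [Algebra k L]

/-- The linear form of the component, attached to a root `r` of `F(T²)`, of the fibre over
`(1 : r²)`. -/
noncomputable def componentForm (g : MvPolynomial (Fin 2) k) (r : L) : MvPolynomial (Fin 3) L :=
  linForm (r ^ 2 + r) (r ^ 4 + r ^ 5 - aeval ![1, r ^ 2] g / r)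

/-- The component, attached to a root `r` of `F(T²)`, of the fibre over `(1 : r²)`. -/
noncomputable def component (g : MvPolynomial (Fin 2) k) (r : L) :
    Projectivization L (Fin 2 → L) × Associates (MvPolynomial (Fin 3) L) :=
  (affinePoint (r ^ 2), Associates.mk (componentForm g r))

theorem fibreMatrix_one_point (g h : MvPolynomial (Fin 2) k) (t : L) :
    fibreMatrix g h ![1, t] = !![-t + t ^ 2, t, aeval ![1, t] g;
      t, 1, t ^ 2; aeval ![1, t] g, t ^ 2, aeval ![1, t] h] := by
  ext i j
  fin_cases i <;> fin_cases j <;> simp [fibreMatrix, conicMatrix]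

/-- With `t = r²` and `F(t) = 0`, the fibre is a difference of squares, of `T₁ + r² T₀ + r⁴ T₂` and
of `r T₀ + (r⁵ - g / r) T₂`. The two factors differ by the sign of `r`. -/
theorem fibre₁_eq_mul_componentForm (H : IsDetPair F g h) {r : L} (hr : r ≠ 0)
    (hF : Polynomial.aeval (r ^ 2) F = 0) : fibre₁ (bundleForm g h) ![1, r ^ 2] =
      componentForm g r * componentForm g (-r) := by
  rw [aeval_eq_of_isDetPair H] at hF
  rw [fibre₁_bundleForm, componentForm, componentForm, neg_sq, fibreMatrix_one_point]
  generalize aeval ![1, r ^ 2] g = a at *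
  generalize aeval ![1, r ^ 2] h = b at *
  have e1 : a = a / r * r := (div_mul_cancel₀ a hr).symm
  -- This is `F(r²) = 0` solved for the value of `h`, which is possible because `r ≠ 0`.
  have e2 : b = r ^ 8 - (r ^ 5 - a / r) ^ 2 := by
    field_simp
    linear_combination hF
  rw [div_neg]
  generalize a / r = w at *
  rw [e2, e1]
  simp [quadForm, linForm, Fin.sum_univ_three]
  ring

theorem componentForm_neg_not_associated (h2 : (2 : L) ≠ 0) {r : L} (hr : r ≠ 0) :
    ¬ componentForm g r ∣ componentForm g (-r) := fun H => by
  have := eq_of_linForm_dvd H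
  have : 2 * r = 0 := by linear_combination this
  simp [h2, hr] at this

theorem map_aeval_one_point {L' : Type*} [Field L'] [Algebra k L'] (φ : L →ₐ[k] L') (t : L)
    (f : MvPolynomial (Fin 2) k) : φ (aeval ![1, t] f) = aeval ![1, φ t] f := by
  refine (map_aeval _ _ f).trans ?_
  rw [aeval_def, ← coe_eval₂Hom]
  congr 2
  · ext a
    simp
  · funext i
    fin_cases i <;> simp

/-- The component depends on `r` through a formula with coefficients in `k`, so it commutes with
every `k`-homomorphism. Applied to automorphisms this is Galois equivariance, applied to inclusions
it is compatibility with base change. -/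
theorem transport_component {L' : Type*} [Field L'] [Algebra k L'] (φ : L →ₐ[k] L') (r : L) :
    transport (φ : L →+* L') (component g r) = component g (φ r) := by
  refine Prod.ext ?_ ?_
  · simp only [transport, component, affinePoint, Projectivization.map_mk]
    congr 1
    funext i
    fin_cases i <;> simp [coordMap]
  · change Associates.mk (map (φ : L →+* L') (componentForm g r)) = _
    rw [componentForm, map_linForm]
    simp [component, componentForm, map_aeval_one_point]

theorem ne_zero_of_aeval_sq_eq_zero (hF0 : F.coeff 0 ≠ 0) {r : L}
    (hr : Polynomial.aeval (r ^ 2) F = 0) : r ≠ 0 := by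
  rintro rfl
  rw [zero_pow two_ne_zero, ← Polynomial.coeff_zero_eq_aeval_zero', map_eq_zero] at hr
  exact hF0 hr

theorem mem_rootSet_comp_sq (hF : F ≠ 0) {r : L} :
    r ∈ (F.comp (Polynomial.X ^ 2)).rootSet L ↔ Polynomial.aeval (r ^ 2) F = 0 := by
  have : F.comp (Polynomial.X ^ 2) ≠ 0 := by
    rw [← Polynomial.expand_eq_comp_X_pow]
    exact (Polynomial.expand_ne_zero two_pos).2 hF
  rw [Polynomial.mem_rootSet, Polynomial.aeval_comp]
  simp [this]

theorem exists_fibre₁_rep_eq (H : IsDetPair F g h) {r : L} (hr : r ≠ 0)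
    (hF : Polynomial.aeval (r ^ 2) F = 0) : ∃ a : L, a ≠ 0 ∧
      fibre₁ (bundleForm g h) (affinePoint (r ^ 2)).rep =
        C (a ^ 2) * (componentForm g r * componentForm g (-r)) := by
  obtain ⟨a, ha, e⟩ := exists_rep_affinePoint (r ^ 2)
  exact ⟨a, ha, by rw [e, fibre₁_smul H.1 H.2.1, fibre₁_eq_mul_componentForm H hr hF]⟩

/-- The point `(1 : r²)` determines `r` up to sign, and the coefficients `r² ± r` of `T₀` separate
the two signs. Surjectivity is unique factorisation: an irreducible factor of a product of two lines
is associated to one of them. The hypothesis `hL` provides the square roots that split the fibres.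
-/
theorem bijOn_component (h2 : (2 : k) ≠ 0) (hF : F ≠ 0) (hF0 : F.coeff 0 ≠ 0)
    (H : IsDetPair F g h) (hL : ∀ t ∈ F.rootSet L, ∃ r, t = r ^ 2) :
    Set.BijOn (component g) ((F.comp (Polynomial.X ^ 2)).rootSet L)
      (degenerateComponents L (bundleForm g h)) := by
  have h2' := two_ne_zero_of_algebra k L h2
  have hmaps : Set.MapsTo (component g) ((F.comp (Polynomial.X ^ 2)).rootSet L)
      (degenerateComponents L (bundleForm g h)) := by
    intro r hr
    have hr' := (mem_rootSet_comp_sq hF).1 hr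
    obtain ⟨a, ha, e⟩ := exists_fibre₁_rep_eq H (ne_zero_of_aeval_sq_eq_zero hF0 hr') hr'
    refine ⟨?_, Associates.irreducible_mk.2 (irreducible_linForm _ _), ?_⟩
    · rw [degeneratePoints_eq h2 hF H]
      exact ⟨_, Polynomial.mem_rootSet.2 ⟨hF, hr'⟩, rfl⟩
    · refine Associates.mk_dvd_mk.2 ?_
      change componentForm g r ∣ fibre₁ (bundleForm g h) (affinePoint (r ^ 2)).rep
      rw [e]
      exact (dvd_mul_right _ _).mul_left _
  refine ⟨hmaps, fun r hr s _ hrs => ?_, ?_⟩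
  · have hr' := (mem_rootSet_comp_sq hF).1 hr
    obtain ⟨e1, e2⟩ := Prod.mk.inj hrs
    rcases sq_eq_sq_iff_eq_or_eq_neg.1 (affinePoint_injective e1) with h | h
    · exact h
    · rw [show s = -r by rw [h, neg_neg]] at e2
      exact absurd (Associates.mk_eq_mk_iff_associated.1 e2).dvd
        (componentForm_neg_not_associated h2' (ne_zero_of_aeval_sq_eq_zero hF0 hr'))
  · rintro ⟨p, a⟩ ⟨hp, hirr, hdvd⟩
    rw [degeneratePoints_eq h2 hF H] at hp
    obtain ⟨t, ht, e⟩ := hp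
    obtain ⟨r, rfl⟩ := hL t ht
    change affinePoint (r ^ 2) = p at e
    subst e
    have hr' := (Polynomial.mem_rootSet.1 ht).2
    have hr0 := ne_zero_of_aeval_sq_eq_zero hF0 hr'
    obtain ⟨c, hc, e⟩ := exists_fibre₁_rep_eq H hr0 hr'
    obtain ⟨q, rfl⟩ := Associates.mk_surjective a
    replace hirr := Associates.irreducible_mk.1 hirr
    replace hdvd := Associates.mk_dvd_mk.1 hdvd
    change q ∣ fibre₁ (bundleForm g h) (affinePoint (r ^ 2)).rep at hdvd
    have hu : IsUnit (C (c ^ 2) : MvPolynomial (Fin 3) L) :=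
      (isUnit_iff_ne_zero.2 (pow_ne_zero 2 hc)).map C
    rw [e, hu.dvd_mul_left] at hdvd
    rcases hirr.prime.dvd_or_dvd hdvd with h | h
    · refine ⟨r, (mem_rootSet_comp_sq hF).2 hr', Prod.ext rfl ?_⟩
      exact Associates.mk_eq_mk_iff_associated.2
        (hirr.associated_of_dvd (irreducible_linForm _ _) h).symm
    · refine ⟨-r, (mem_rootSet_comp_sq hF).2 (by rwa [neg_sq]), Prod.ext ?_ ?_⟩
      · simp [component]
      · exact Associates.mk_eq_mk_iff_associated.2
          (hirr.associated_of_dvd (irreducible_linForm _ _) h).symm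

end Components

/-! ### The splitting field of `F(T²)`. -/

section SplittingField

variable {k : Type*} [Field k] {F : Polynomial k}

/-- The derivative is `2 T F'(T²)`. Here 2 is a unit, `T` is coprime to `F(T²)` because `F(0) ≠ 0`,
and `F'(T²)` is coprime to it by substitution in a Bézout identity. -/
theorem separable_comp_sq (h2 : (2 : k) ≠ 0) (hs : F.Separable) (hF0 : F.coeff 0 ≠ 0) :
    (F.comp (Polynomial.X ^ 2)).Separable := by
  rw [Polynomial.separable_def, Polynomial.derivative_comp, Polynomial.derivative_X_pow]
  have h1 : IsCoprime (F.comp (Polynomial.X ^ 2)) (F.derivative.comp (Polynomial.X ^ 2)) :=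
    IsCoprime.map hs (Polynomial.compRingHom (Polynomial.X ^ 2))
  have h3 : IsCoprime (F.comp (Polynomial.X ^ 2)) Polynomial.X := by
    refine ((Polynomial.irreducible_X.coprime_iff_not_dvd).2 fun hd => hF0 ?_).symm
    rw [Polynomial.X_dvd_iff, Polynomial.coeff_zero_eq_eval_zero, Polynomial.eval_comp] at hd
    rw [Polynomial.coeff_zero_eq_eval_zero]
    simpa using hd
  have h4 : IsCoprime (F.comp (Polynomial.X ^ 2)) (Polynomial.C (2 : k)) :=
    isCoprime_one_right.of_isCoprime_of_dvd_right
      ((isUnit_iff_ne_zero.2 h2).map Polynomial.C).dvd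
  refine IsCoprime.mul_right ?_ h1
  simpa using h4.mul_right h3

variable {l : Type*} [Field l] [Algebra k l]
  [Polynomial.IsSplittingField k l (F.comp (Polynomial.X ^ 2))]

theorem isGalois_splittingField (h2 : (2 : k) ≠ 0) (hs : F.Separable) (hF0 : F.coeff 0 ≠ 0) :
    IsGalois k l :=
  IsGalois.of_separable_splitting_field (p := F.comp (Polynomial.X ^ 2))
    (separable_comp_sq h2 hs hF0)

variable {Ω : Type*} [Field Ω] [Algebra k Ω] [Algebra l Ω] [IsScalarTower k l Ω]

theorem image_rootSet_comp_sq : algebraMap l Ω '' (F.comp (Polynomial.X ^ 2)).rootSet l =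
    (F.comp (Polynomial.X ^ 2)).rootSet Ω :=
  (Polynomial.IsSplittingField.splits l (F.comp (Polynomial.X ^ 2))).image_rootSet
    (IsScalarTower.toAlgHom k l Ω)

variable (l) in
-- A square root of `t` exists in an algebraic closure of `Ω`. It is a root of `F(T²)`, and all such
-- roots already come from `l`.
theorem exists_sq_of_mem_rootSet (hF : F ≠ 0) {t : Ω} (ht : t ∈ F.rootSet Ω) :
    ∃ r ∈ (F.comp (Polynomial.X ^ 2)).rootSet l, t = algebraMap l Ω r ^ 2 := by
  obtain ⟨s, hs⟩ := IsAlgClosed.exists_pow_nat_eq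
    (algebraMap Ω (AlgebraicClosure Ω) t) (n := 2) two_pos
  have hs' : s ∈ (F.comp (Polynomial.X ^ 2)).rootSet (AlgebraicClosure Ω) := by
    rw [mem_rootSet_comp_sq hF, hs, Polynomial.aeval_algebraMap_apply,
      (Polynomial.mem_rootSet.1 ht).2, map_zero]
  rw [← image_rootSet_comp_sq (l := l)] at hs'
  obtain ⟨r, hr, rfl⟩ := hs'
  refine ⟨r, hr, (algebraMap Ω (AlgebraicClosure Ω)).injective ?_⟩
  rw [← hs, map_pow, ← IsScalarTower.algebraMap_apply]

variable (l) in
theorem ncard_rootSet_of_splittingField (hs : F.Separable) :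
    (F.rootSet l).ncard = F.natDegree := by
  have himg : algebraMap l (AlgebraicClosure l) '' F.rootSet l = F.rootSet (AlgebraicClosure l) := by
    ext t
    constructor
    · rintro ⟨r, hr, rfl⟩
      rw [Polynomial.mem_rootSet, Polynomial.aeval_algebraMap_apply,
        (Polynomial.mem_rootSet.1 hr).2, map_zero]
      exact ⟨hs.ne_zero, rfl⟩
    · intro ht
      obtain ⟨r, hr, rfl⟩ := exists_sq_of_mem_rootSet l hs.ne_zero ht
      exact ⟨r ^ 2, Polynomial.mem_rootSet.2 ⟨hs.ne_zero, (mem_rootSet_comp_sq hs.ne_zero).1 hr⟩,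
        map_pow _ _ _⟩
  rw [← Set.ncard_image_of_injective _ (algebraMap l (AlgebraicClosure l)).injective, himg,
    ← Nat.card_coe_set_eq, Nat.card_eq_fintype_card,
    Polynomial.card_rootSet_eq_natDegree hs (IsAlgClosed.splits _)]

variable {g h : MvPolynomial (Fin 2) k}

theorem bijOn_component_of_splittingField (l : Type*) [Field l] [Algebra k l]
    [Polynomial.IsSplittingField k l (F.comp (Polynomial.X ^ 2))] (Ω : Type*) [Field Ω]
    [Algebra k Ω] [Algebra l Ω] [IsScalarTower k l Ω]
    (h2 : (2 : k) ≠ 0) (hF : F ≠ 0) (hF0 : F.coeff 0 ≠ 0)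
    (H : IsDetPair F g h) :
    Set.BijOn (component g) ((F.comp (Polynomial.X ^ 2)).rootSet Ω)
      (degenerateComponents Ω (bundleForm g h)) :=
  bijOn_component h2 hF hF0 H fun _ ht =>
    let ⟨r, _, e⟩ := exists_sq_of_mem_rootSet l hF ht
    ⟨algebraMap l Ω r, e⟩

/-- Components over `l` and over `Ω` are both parametrised by the roots of `F(T²)`, compatibly with
`transport`, and these roots are the same in both fields. -/
theorem bijOn_transport (h2 : (2 : k) ≠ 0) (hF : F ≠ 0) (hF0 : F.coeff 0 ≠ 0)
    (H : IsDetPair F g h) : Set.BijOn (transport (algebraMap l Ω))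
      (degenerateComponents l (bundleForm g h)) (degenerateComponents Ω (bundleForm g h)) := by
  have hl := bijOn_component_of_splittingField l l h2 hF hF0 H
  have hΩ := bijOn_component_of_splittingField l Ω h2 hF hF0 H
  have hφ : Set.BijOn (algebraMap l Ω) ((F.comp (Polynomial.X ^ 2)).rootSet l)
      ((F.comp (Polynomial.X ^ 2)).rootSet Ω) := by
    rw [← image_rootSet_comp_sq (l := l) (Ω := Ω)]
    exact (algebraMap l Ω).injective.injOn.bijOn_image
  refine (Set.bijOn_comp_iff hl.injOn |>.1 ?_ : Set.BijOn _ _ _) |> fun h => hl.image_eq ▸ h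
  refine (hΩ.comp hφ).congr fun r _ => ?_
  exact (transport_component (g := g) (IsScalarTower.toAlgHom k l Ω) r).symm

theorem degenerateFibres_claims (h2 : (2 : k) ≠ 0) (hs : F.Separable) (hF0 : F.coeff 0 ≠ 0)
    (H : IsDetPair F g h) :
    (degeneratePoints l (bundleForm g h)).ncard = F.natDegree ∧
      ∀ p ∈ degeneratePoints l (bundleForm g h), ∃ l₁ l₂ : MvPolynomial (Fin 3) l,
        l₁.IsHomogeneous 1 ∧ l₂.IsHomogeneous 1 ∧ ¬ Associated l₁ l₂ ∧
          fibre₁ (bundleForm g h) p.rep = l₁ * l₂ := by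
  rw [degeneratePoints_eq h2 hs.ne_zero H]
  refine ⟨?_, ?_⟩
  · rw [Set.ncard_image_of_injective _ affinePoint_injective, ncard_rootSet_of_splittingField l hs]
  · rintro _ ⟨t, ht, rfl⟩
    obtain ⟨r, hr, rfl⟩ := exists_sq_of_mem_rootSet l hs.ne_zero ht
    have hr' := (mem_rootSet_comp_sq hs.ne_zero).1 hr
    have hr0 := ne_zero_of_aeval_sq_eq_zero hF0 hr'
    obtain ⟨a, ha, e⟩ := exists_fibre₁_rep_eq H hr0 hr'
    -- The square of the scaling factor of the chosen representative is absorbed into the first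
    -- line.
    refine ⟨C (a ^ 2) * componentForm g r, componentForm g (-r),
      IsHomogeneous.C_mul (isHomogeneous_linForm _ _) _, isHomogeneous_linForm _ _, fun hA => ?_,
      by rw [mul_assoc]; exact e⟩
    exact componentForm_neg_not_associated (two_ne_zero_of_algebra k l h2) hr0
      ((dvd_mul_left _ _).trans hA.dvd)

end SplittingField

/-! ### The forms `Q₀`, `Q₁`, `Q₂` and the branch quartic. -/

section CoefficientForms

variable {k : Type*} [CommRing k]

/-- The coefficient `Q₀` of `s²` in the form of the conic bundle. -/
noncomputable def formQ₀ (g h : MvPolynomial (Fin 2) k) : MvPolynomial (Fin 3) k :=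
  quadForm ((conicMatrix g h).map (coeff (Finsupp.single 0 2)))

/-- The coefficient `Q₁` of `s t` in the form of the conic bundle. -/
noncomputable def formQ₁ (g h : MvPolynomial (Fin 2) k) : MvPolynomial (Fin 3) k :=
  quadForm ((conicMatrix g h).map (coeff (Finsupp.single 0 1 + Finsupp.single 1 1)))

/-- The coefficient `Q₂` of `t²` in the form of the conic bundle. -/
noncomputable def formQ₂ (g h : MvPolynomial (Fin 2) k) : MvPolynomial (Fin 3) k :=
  quadForm ((conicMatrix g h).map (coeff (Finsupp.single 1 2)))

variable {K : Type*} [CommRing K] [Algebra k K]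

theorem fibre₂_bundleForm {g h : MvPolynomial (Fin 2) k} (hg : g.IsHomogeneous 2)
    (hh : h.IsHomogeneous 2) (x : Fin 3 → K) : fibre₂ (bundleForm g h) x =
      binForm (aeval x (formQ₀ g h)) (aeval x (formQ₁ g h)) (aeval x (formQ₂ g h)) := by
  have key : ∀ f : MvPolynomial (Fin 2) k, f.IsHomogeneous 2 → ∀ a b : K,
      C a * map (algebraMap k K) f * C b =
        C (a * algebraMap k K (f.coeff (Finsupp.single 0 2)) * b) * X 0 ^ 2 +
        C (a * algebraMap k K (f.coeff (Finsupp.single 0 1 + Finsupp.single 1 1)) * b) *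
          (X 0 * X 1) +
        C (a * algebraMap k K (f.coeff (Finsupp.single 1 2)) * b) * X 1 ^ 2 := fun f hf a b => by
    conv_lhs => rw [eq_binForm_of_isHomogeneous hf]
    simp only [binForm, map_add, map_mul, map_pow, map_C, map_X]
    ring
  rw [fibre₂, bundleForm]
  simp only [eval₂_sum, eval₂_mul, eval₂_X, eval₂_C, key _ (isHomogeneous_conicMatrix hg hh _ _),
    Finset.sum_add_distrib, ← Finset.sum_mul, ← map_sum]
  simp only [formQ₀, formQ₁, formQ₂, quadForm, map_sum, map_mul, aeval_X, aeval_C, binForm,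
    Matrix.map_apply]

theorem branchForm_bundleForm {g h : MvPolynomial (Fin 2) k} (hg : g.IsHomogeneous 2)
    (hh : h.IsHomogeneous 2) : branchForm (bundleForm g h) =
      formQ₁ g h ^ 2 - 4 * formQ₀ g h * formQ₂ g h := by
  rw [branchForm, fibre₂_bundleForm hg hh, binaryDiscr, coeff_binForm_zero, coeff_binForm_mixed,
    coeff_binForm_one, aeval_X_left_apply, aeval_X_left_apply, aeval_X_left_apply]

theorem isHomogeneous_branchForm {g h : MvPolynomial (Fin 2) k} (hg : g.IsHomogeneous 2)
    (hh : h.IsHomogeneous 2) : (branchForm (bundleForm g h)).IsHomogeneous 4 := by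
  rw [branchForm_bundleForm hg hh]
  refine ((isHomogeneous_quadForm _).pow 2).sub ?_
  rw [mul_assoc, ← map_ofNat C 4]
  exact IsHomogeneous.C_mul ((isHomogeneous_quadForm _).mul (isHomogeneous_quadForm _)) _

theorem conicMatrix_eq_binForm (g h : MvPolynomial (Fin 2) k) :
    conicMatrix g h = !![binForm 0 (-1) 1, binForm 0 1 0, g;
      binForm 0 1 0, binForm 1 0 0, binForm 0 0 1; g, binForm 0 0 1, h] := by
  simp [conicMatrix, binForm]

theorem coeff_conicMatrix_zero (g h : MvPolynomial (Fin 2) k) :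
    (conicMatrix g h).map (coeff (Finsupp.single 0 2)) =
      !![0, 0, g.coeff (Finsupp.single 0 2); 0, 1, 0;
        g.coeff (Finsupp.single 0 2), 0, h.coeff (Finsupp.single 0 2)] := by
  rw [conicMatrix_eq_binForm]
  ext i j
  fin_cases i <;> fin_cases j <;> simp

theorem coeff_conicMatrix_mixed (g h : MvPolynomial (Fin 2) k) :
    (conicMatrix g h).map (coeff (Finsupp.single 0 1 + Finsupp.single 1 1)) =
      !![-1, 1, g.coeff (Finsupp.single 0 1 + Finsupp.single 1 1); 1, 0, 0;
        g.coeff (Finsupp.single 0 1 + Finsupp.single 1 1), 0,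
        h.coeff (Finsupp.single 0 1 + Finsupp.single 1 1)] := by
  rw [conicMatrix_eq_binForm]
  ext i j
  fin_cases i <;> fin_cases j <;> simp [-coeff_add, coeff_binForm_mixed]

theorem coeff_conicMatrix_one (g h : MvPolynomial (Fin 2) k) :
    (conicMatrix g h).map (coeff (Finsupp.single 1 2)) =
      !![1, 0, g.coeff (Finsupp.single 1 2); 0, 0, 1;
        g.coeff (Finsupp.single 1 2), 1, h.coeff (Finsupp.single 1 2)] := by
  rw [conicMatrix_eq_binForm]
  ext i j
  fin_cases i <;> fin_cases j <;> simp

theorem aeval_formQ₀ (g h : MvPolynomial (Fin 2) k) (x : Fin 3 → K) :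
    aeval x (formQ₀ g h) = x 1 ^ 2 +
      2 * algebraMap k K (g.coeff (Finsupp.single 0 2)) * x 0 * x 2 +
      algebraMap k K (h.coeff (Finsupp.single 0 2)) * x 2 ^ 2 := by
  rw [formQ₀, coeff_conicMatrix_zero]
  simp [quadForm, Fin.sum_univ_three]
  ring

theorem aeval_formQ₁ (g h : MvPolynomial (Fin 2) k) (x : Fin 3 → K) :
    aeval x (formQ₁ g h) = -x 0 ^ 2 + 2 * x 0 * x 1 +
      2 * algebraMap k K (g.coeff (Finsupp.single 0 1 + Finsupp.single 1 1)) * x 0 * x 2 +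
      algebraMap k K (h.coeff (Finsupp.single 0 1 + Finsupp.single 1 1)) * x 2 ^ 2 := by
  rw [formQ₁, coeff_conicMatrix_mixed]
  simp [quadForm, Fin.sum_univ_three]
  ring

theorem aeval_formQ₂ (g h : MvPolynomial (Fin 2) k) (x : Fin 3 → K) :
    aeval x (formQ₂ g h) = x 0 ^ 2 + 2 * x 1 * x 2 +
      2 * algebraMap k K (g.coeff (Finsupp.single 1 2)) * x 0 * x 2 +
      algebraMap k K (h.coeff (Finsupp.single 1 2)) * x 2 ^ 2 := by
  rw [formQ₂, coeff_conicMatrix_one]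
  simp [quadForm, Fin.sum_univ_three]
  ring

theorem branchForm_ne_zero [Nontrivial k] {g h : MvPolynomial (Fin 2) k} (hg : g.IsHomogeneous 2)
    (hh : h.IsHomogeneous 2) : branchForm (bundleForm g h) ≠ 0 := by
  intro H
  -- At `(1 : 0 : 0)` one has `Q₀ = 0` and `Q₁ = -1`, so the quartic takes the value 1.
  have := congrArg (aeval (![1, 0, 0] : Fin 3 → k)) H
  rw [branchForm_bundleForm hg hh] at this
  simp only [map_sub, map_mul, map_pow, aeval_formQ₀, aeval_formQ₁] at this
  simp at this

theorem aeval_fibre₁ {g h : MvPolynomial (Fin 2) k} (hg : g.IsHomogeneous 2)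
    (hh : h.IsHomogeneous 2) (v : Fin 2 → K) (w : Fin 3 → K) :
    aeval w (fibre₁ (bundleForm g h) v) = aeval w (formQ₀ g h) * v 0 ^ 2 +
      aeval w (formQ₁ g h) * (v 0 * v 1) + aeval w (formQ₂ g h) * v 1 ^ 2 := by
  have hg' := congrArg (aeval v) (eq_binForm_of_isHomogeneous hg)
  have hh' := congrArg (aeval v) (eq_binForm_of_isHomogeneous hh)
  rw [aeval_binForm] at hg' hh'
  rw [fibre₁_bundleForm, aeval_quadForm, aeval_formQ₀, aeval_formQ₁, aeval_formQ₂]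
  simp [Matrix.mulVec, dotProduct, fibreMatrix, conicMatrix, Fin.sum_univ_three, hg', hh']
  ring

/-- The pull-back to `v` of the matrix of the conic bundle in terms of its coefficients. -/
theorem fibreMatrix_eq {g h : MvPolynomial (Fin 2) k} (hg : g.IsHomogeneous 2)
    (hh : h.IsHomogeneous 2) (v : Fin 2 → K) : fibreMatrix g h v =
      v 0 ^ 2 • ((conicMatrix g h).map (coeff (Finsupp.single 0 2))).map (algebraMap k K) +
      (v 0 * v 1) • ((conicMatrix g h).map
        (coeff (Finsupp.single 0 1 + Finsupp.single 1 1))).map (algebraMap k K) +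
      v 1 ^ 2 • ((conicMatrix g h).map (coeff (Finsupp.single 1 2))).map (algebraMap k K) := by
  ext i j
  have := congrArg (aeval v) (eq_binForm_of_isHomogeneous (isHomogeneous_conicMatrix hg hh i j))
  rw [aeval_binForm] at this
  refine this.trans ?_
  simp only [Matrix.add_apply, Matrix.smul_apply, Matrix.map_apply, smul_eq_mul]
  ring

theorem aeval_pderiv_branchForm {g h : MvPolynomial (Fin 2) k} (hg : g.IsHomogeneous 2)
    (hh : h.IsHomogeneous 2) (x : Fin 3 → K) (i : Fin 3) :
    aeval x (pderiv i (branchForm (bundleForm g h))) =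
      2 * aeval x (formQ₁ g h) * aeval x (pderiv i (formQ₁ g h)) -
      4 * (aeval x (formQ₀ g h) * aeval x (pderiv i (formQ₂ g h)) +
        aeval x (formQ₂ g h) * aeval x (pderiv i (formQ₀ g h))) := by
  rw [branchForm_bundleForm hg hh, mul_assoc, ← map_ofNat C 4]
  rw [map_sub, pderiv_C_mul, pderiv_mul, pderiv_pow]
  simp [map_ofNat]
  ring

end CoefficientForms

/-! ### The exceptional locus `Z` as common roots of a quartic and a cubic. -/

section FullFibres

variable {k : Type*} [CommRing k]

/-- The quartic polynomial whose roots are the first coordinates of the points `Q₀ = Q₂ = 0`. -/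
noncomputable def fullQuartic (a c a' c' : k) : Polynomial k :=
  (Polynomial.X ^ 2 + Polynomial.C (2 * c) * Polynomial.X + Polynomial.C c') ^ 2 +
    Polynomial.C (8 * a) * Polynomial.X + Polynomial.C (4 * a')

/-- The cubic polynomial that vanishes at the first coordinates of the points `Q₁ = Q₂ = 0`. -/
noncomputable def fullCubic (b c b' c' : k) : Polynomial k :=
  Polynomial.X ^ 3 + Polynomial.C (2 * c + 1) * Polynomial.X ^ 2 +
    Polynomial.C (c' - 2 * b) * Polynomial.X - Polynomial.C b'

theorem fullQuartic_eq (a c a' c' : k) : fullQuartic a c a' c' =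
    Polynomial.X ^ 4 + Polynomial.C (4 * c) * Polynomial.X ^ 3 +
      Polynomial.C (4 * c ^ 2 + 2 * c') * Polynomial.X ^ 2 +
      Polynomial.C (4 * c * c' + 8 * a) * Polynomial.X + Polynomial.C (c' ^ 2 + 4 * a') := by
  simp only [fullQuartic, map_mul, map_add, map_pow, map_ofNat]
  ring

theorem monic_fullQuartic [Nontrivial k] (a c a' c' : k) : (fullQuartic a c a' c').Monic := by
  rw [fullQuartic_eq]
  monicity!

theorem natDegree_fullQuartic [Nontrivial k] (a c a' c' : k) :
    (fullQuartic a c a' c').natDegree = 4 := by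
  rw [fullQuartic_eq]
  compute_degree!

theorem natDegree_fullCubic [Nontrivial k] (b c b' c' : k) :
    (fullCubic b c b' c').natDegree = 3 := by
  rw [fullCubic]
  compute_degree!

theorem map_fullQuartic {R : Type*} [CommRing R] (φ : k →+* R) (a c a' c' : k) :
    (fullQuartic a c a' c').map φ = fullQuartic (φ a) (φ c) (φ a') (φ c') := by
  simp [fullQuartic, map_ofNat]

theorem map_fullCubic {R : Type*} [CommRing R] (φ : k →+* R) (b c b' c' : k) :
    (fullCubic b c b' c').map φ = fullCubic (φ b) (φ c) (φ b') (φ c') := by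
  simp [fullCubic, map_ofNat]

/-- The quartic polynomial attached to the pair `(g, h)`. -/
noncomputable def pairQuartic (g h : MvPolynomial (Fin 2) k) : Polynomial k :=
  fullQuartic (g.coeff (Finsupp.single 0 2)) (g.coeff (Finsupp.single 1 2))
    (h.coeff (Finsupp.single 0 2)) (h.coeff (Finsupp.single 1 2))

/-- The cubic polynomial attached to the pair `(g, h)`. -/
noncomputable def pairCubic (g h : MvPolynomial (Fin 2) k) : Polynomial k :=
  fullCubic (g.coeff (Finsupp.single 0 1 + Finsupp.single 1 1)) (g.coeff (Finsupp.single 1 2))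
    (h.coeff (Finsupp.single 0 1 + Finsupp.single 1 1)) (h.coeff (Finsupp.single 1 2))

end FullFibres

section FullFibrePoints

variable {k : Type*} [Field k] {g h : MvPolynomial (Fin 2) k}
variable {K : Type*} [Field K] [Algebra k K]

/-- The point with first coordinate `a` on the affine part of the conic `Q₂ = 0`. -/
noncomputable def conicPoint (g h : MvPolynomial (Fin 2) k) (a : K) : Fin 3 → K :=
  ![a, -(a ^ 2 + 2 * algebraMap k K (g.coeff (Finsupp.single 1 2)) * a +
    algebraMap k K (h.coeff (Finsupp.single 1 2))) / 2, 1]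

theorem conicPoint_ne_zero (g h : MvPolynomial (Fin 2) k) (a : K) : conicPoint g h a ≠ 0 :=
  fun H => one_ne_zero (congrFun H 2)

/-- On `T₂ = 0` the forms `Q₀` and `Q₁` reduce to `T₁²` and `-T₀² + 2 T₀ T₁`, so there is no common
zero there. On `T₂ = 1` the equation `Q₂ = 0` is linear in `T₁`; substituting its solution into `4
Q₀` gives the quartic, and `T₀ Q₂ - Q₁` is the cubic. -/
theorem exists_eq_smul_conicPoint (h2 : (2 : k) ≠ 0) {v : Fin 3 → K} (hv : v ≠ 0)
    (e0 : aeval v (formQ₀ g h) = 0) (e1 : aeval v (formQ₁ g h) = 0)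
    (e2 : aeval v (formQ₂ g h) = 0) : ∃ a b : K, v = b • conicPoint g h a ∧
      Polynomial.aeval a (pairQuartic g h) = 0 ∧ Polynomial.aeval a (pairCubic g h) = 0 := by
  have h2' := two_ne_zero_of_algebra k K h2
  rw [aeval_formQ₀] at e0
  rw [aeval_formQ₁] at e1
  rw [aeval_formQ₂] at e2
  simp only [pairQuartic, pairCubic, fullQuartic, fullCubic, conicPoint, map_add, map_mul, map_sub,
    map_pow, Polynomial.aeval_X, Polynomial.aeval_C, map_ofNat, map_one]
  generalize algebraMap k K (g.coeff (Finsupp.single 0 2)) = g0 at *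
  generalize algebraMap k K (g.coeff (Finsupp.single 0 1 + Finsupp.single 1 1)) = g1 at *
  generalize algebraMap k K (g.coeff (Finsupp.single 1 2)) = g2 at *
  generalize algebraMap k K (h.coeff (Finsupp.single 0 2)) = h0 at *
  generalize algebraMap k K (h.coeff (Finsupp.single 0 1 + Finsupp.single 1 1)) = h1 at *
  generalize algebraMap k K (h.coeff (Finsupp.single 1 2)) = h2 at *
  by_cases hz : v 2 = 0
  · exfalso
    rw [hz] at e0 e1
    have hy : v 1 = 0 := by simpa using e0
    have hx : v 0 = 0 := by simpa [hy] using e1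
    apply hv
    ext i
    fin_cases i <;> assumption
  · obtain ⟨x, hx⟩ : ∃ x, v 0 = v 2 * x := ⟨v 0 / v 2, by field_simp⟩
    obtain ⟨y, hy⟩ : ∃ y, v 1 = v 2 * y := ⟨v 1 / v 2, by field_simp⟩
    rw [hx, hy] at e0 e1 e2
    have f0 : y ^ 2 + 2 * g0 * x + h0 = 0 :=
      (mul_eq_zero.1 (show v 2 ^ 2 * _ = 0 by linear_combination e0)).resolve_left
        (pow_ne_zero 2 hz)
    have f1 : -x ^ 2 + 2 * x * y + 2 * g1 * x + h1 = 0 :=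
      (mul_eq_zero.1 (show v 2 ^ 2 * _ = 0 by linear_combination e1)).resolve_left
        (pow_ne_zero 2 hz)
    have f2 : x ^ 2 + 2 * y + 2 * g2 * x + h2 = 0 :=
      (mul_eq_zero.1 (show v 2 ^ 2 * _ = 0 by linear_combination e2)).resolve_left
        (pow_ne_zero 2 hz)
    refine ⟨x, v 2, ?_, ?_, ?_⟩
    · have hy' : -(x ^ 2 + 2 * g2 * x + h2) / 2 = y := by
        field_simp
        linear_combination -f2
      rw [hy']
      ext i
      fin_cases i <;> simp [hx, hy]
    · linear_combination 4 * f0 + (x ^ 2 + 2 * g2 * x + h2 - 2 * y) * f2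
    · linear_combination x * f2 - f1

theorem aeval_conicPoint_eq_zero (h2 : (2 : k) ≠ 0) {a : K}
    (hq : Polynomial.aeval a (pairQuartic g h) = 0) (hc : Polynomial.aeval a (pairCubic g h) = 0) :
    aeval (conicPoint g h a) (formQ₀ g h) = 0 ∧ aeval (conicPoint g h a) (formQ₁ g h) = 0 ∧
      aeval (conicPoint g h a) (formQ₂ g h) = 0 := by
  have h2' := two_ne_zero_of_algebra k K h2
  rw [aeval_formQ₀, aeval_formQ₁, aeval_formQ₂]
  simp only [pairQuartic, pairCubic, fullQuartic, fullCubic, conicPoint, map_add, map_mul, map_sub,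
    map_pow, Polynomial.aeval_X, Polynomial.aeval_C, map_ofNat, map_one] at *
  generalize algebraMap k K (g.coeff (Finsupp.single 0 2)) = g0 at *
  generalize algebraMap k K (g.coeff (Finsupp.single 0 1 + Finsupp.single 1 1)) = g1 at *
  generalize algebraMap k K (g.coeff (Finsupp.single 1 2)) = g2 at *
  generalize algebraMap k K (h.coeff (Finsupp.single 0 2)) = h0 at *
  generalize algebraMap k K (h.coeff (Finsupp.single 0 1 + Finsupp.single 1 1)) = h1 at *
  generalize algebraMap k K (h.coeff (Finsupp.single 1 2)) = h2 at *
  obtain ⟨y, hy⟩ : ∃ y, -(a ^ 2 + 2 * g2 * a + h2) / 2 = y := ⟨_, rfl⟩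
  rw [hy]
  simp only [Matrix.cons_val_zero, Matrix.cons_val_one, Matrix.cons_val, mul_one, one_pow]
  have f2 : a ^ 2 + 2 * g2 * a + h2 = -2 * y := by
    rw [← hy]
    field_simp
  have h4 : (4 : K) ≠ 0 := by
    rw [show (4 : K) = 2 * 2 by norm_num]
    exact mul_ne_zero h2' h2'
  refine ⟨(mul_eq_zero.1 (show (4 : K) * _ = 0 from ?_)).resolve_left h4, ?_, ?_⟩
  · linear_combination hq - (a ^ 2 + 2 * g2 * a + h2 - 2 * y) * f2
  · linear_combination -hc + a * f2
  · linear_combination f2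

theorem isCoprime_pair_iff (h2 : (2 : k) ≠ 0) : IsCoprime (pairQuartic g h) (pairCubic g h) ↔
    ∀ v : Fin 3 → AlgebraicClosure k, aeval v (formQ₀ g h) = 0 → aeval v (formQ₁ g h) = 0 →
      aeval v (formQ₂ g h) = 0 → v = 0 := by
  rw [Polynomial.isCoprime_iff_aeval_ne_zero_of_isAlgClosed k (AlgebraicClosure k)]
  constructor
  · intro H v e0 e1 e2
    by_contra hv
    obtain ⟨a, -, -, hq, hc⟩ := exists_eq_smul_conicPoint h2 hv e0 e1 e2
    exact (H a).elim (fun H => H hq) (fun H => H hc)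
  · intro H a
    by_contra! hqc
    obtain ⟨e0, e1, e2⟩ := aeval_conicPoint_eq_zero h2 hqc.1 hqc.2
    exact conicPoint_ne_zero g h a (H _ e0 e1 e2)

/-- A Bézout identity over `k` persists in every extension field. This is used for the algebraic
closure and for residue fields of local rings. -/
theorem eq_zero_of_isCoprime_pair (h2 : (2 : k) ≠ 0)
    (H : IsCoprime (pairQuartic g h) (pairCubic g h)) {v : Fin 3 → K}
    (e0 : aeval v (formQ₀ g h) = 0) (e1 : aeval v (formQ₁ g h) = 0)
    (e2 : aeval v (formQ₂ g h) = 0) : v = 0 := by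
  by_contra hv
  obtain ⟨a, -, -, hq, hc⟩ := exists_eq_smul_conicPoint h2 hv e0 e1 e2
  obtain ⟨p, q, hpq⟩ := H
  have := congrArg (Polynomial.aeval a) hpq
  simp [hq, hc] at this

theorem mem_fullFibrePoints_iff (hg : g.IsHomogeneous 2) (hh : h.IsHomogeneous 2)
    (x : Projectivization K (Fin 3 → K)) : x ∈ fullFibrePoints K (bundleForm g h) ↔
      aeval x.rep (formQ₀ g h) = 0 ∧ aeval x.rep (formQ₁ g h) = 0 ∧
        aeval x.rep (formQ₂ g h) = 0 := by
  change fibre₂ (bundleForm g h) x.rep = 0 ↔ _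
  rw [fibre₂_bundleForm hg hh, show (0 : MvPolynomial (Fin 2) K) = binForm 0 0 0 by simp [binForm],
    binForm_injective]

/-- The quartic is monic for every pair `(g, h)`, so its finitely many roots bound `Z` with no
genericity assumption. -/
theorem finite_fullFibrePoints (h2 : (2 : k) ≠ 0) (hg : g.IsHomogeneous 2)
    (hh : h.IsHomogeneous 2) : (fullFibrePoints K (bundleForm g h)).Finite := by
  refine ((Polynomial.rootSet_finite (pairQuartic g h) K).image
    fun a => Projectivization.mk K (conicPoint g h a) (conicPoint_ne_zero g h a)).subset ?_
  intro x hx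
  obtain ⟨e0, e1, e2⟩ := (mem_fullFibrePoints_iff hg hh x).1 hx
  obtain ⟨a, b, hab, hq, -⟩ := exists_eq_smul_conicPoint h2 x.rep_nonzero e0 e1 e2
  refine ⟨a, Polynomial.mem_rootSet.2 ⟨(monic_fullQuartic _ _ _ _).ne_zero, hq⟩, ?_⟩
  conv_rhs => rw [← x.mk_rep]
  refine ((Projectivization.mk_eq_mk_iff' K _ _ _ _).2 ⟨b, hab.symm⟩).symm

/-- Each term of `Q₁² - 4 Q₀ Q₂` is of order at least two in the `Qᵢ`. -/
theorem singular_of_mem_fullFibrePoints (hg : g.IsHomogeneous 2) (hh : h.IsHomogeneous 2)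
    {x : Projectivization K (Fin 3 → K)} (hx : x ∈ fullFibrePoints K (bundleForm g h)) :
    aeval x.rep (branchForm (bundleForm g h)) = 0 ∧
      ∀ i, aeval x.rep (pderiv i (branchForm (bundleForm g h))) = 0 := by
  obtain ⟨e0, e1, e2⟩ := (mem_fullFibrePoints_iff hg hh x).1 hx
  refine ⟨?_, fun i => ?_⟩
  · rw [branchForm_bundleForm hg hh]
    simp only [map_sub, map_mul, map_pow, e0, e1]
    ring
  · rw [aeval_pderiv_branchForm hg hh, e0, e1, e2]
    ring

theorem isCoprime_pair_of_isNonsingular (h2 : (2 : k) ≠ 0) (hg : g.IsHomogeneous 2)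
    (hh : h.IsHomogeneous 2) (H : IsNonsingular (branchForm (bundleForm g h))) :
    IsCoprime (pairQuartic g h) (pairCubic g h) := by
  rw [isCoprime_pair_iff h2]
  intro v e0 e1 e2
  by_contra hv
  obtain ⟨i, hi⟩ := H v hv (by
    rw [branchForm_bundleForm hg hh]
    simp only [map_sub, map_mul, map_pow, e0, e1]
    ring)
  rw [aeval_pderiv_branchForm hg hh, e0, e1, e2] at hi
  simp at hi

end FullFibrePoints

/-! ### Quadratic algebras and the double cover. -/

section QuadraticAlgebras

variable {R : Type*} [CommRing R]

/-- The entries of the trace matrix follow from `tr 1 = 2`, `tr e₁ = -b` and `e₁² = -b e₁ - c`. -/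
theorem discr_of_sq_eq {B : Type*} [CommRing B] [Algebra R B] (e : Module.Basis (Fin 2) R B)
    (h0 : e 0 = 1) {b c : R} (h1 : e 1 * e 1 = -(b • e 1) - c • e 0) :
    Algebra.discr R e = b ^ 2 - 4 * c := by
  have tr : ∀ x, Algebra.trace R B x = e.repr (x * e 0) 0 + e.repr (x * e 1) 1 := fun x => by
    rw [Algebra.trace_eq_matrix_trace e, Matrix.trace_fin_two, Algebra.leftMulMatrix_eq_repr_mul,
      Algebra.leftMulMatrix_eq_repr_mul]
  have t0 : Algebra.trace R B (e 0) = 2 := by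
    rw [tr, h0, one_mul, one_mul, ← h0]
    simp
    norm_num
  have t1 : Algebra.trace R B (e 1) = -b := by
    rw [tr, h1, h0, mul_one, ← h0]
    simp
  rw [Algebra.discr_def, Matrix.det_fin_two]
  simp only [Algebra.traceMatrix_apply, Algebra.traceForm_apply]
  have e01 : e 0 * e 1 = e 1 := by rw [h0, one_mul]
  have e10 : e 1 * e 0 = e 1 := by rw [h0, mul_one]
  have e00 : e 0 * e 0 = e 0 := by rw [h0, mul_one]
  rw [e01, e10, e00, h1, map_sub, map_neg, map_smul, map_smul, t0, t1]
  simp only [smul_eq_mul]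
  ring

/-- Division by the unit `A` makes the polynomial monic without changing the quotient ring, and
changes the discriminant by the unit `A²`. -/
theorem exists_basis_adjoinRoot_quadratic [Nontrivial R] {f : Polynomial R} {A B D d : R}
    (hf : f = Polynomial.C A * Polynomial.X ^ 2 + Polynomial.C B * Polynomial.X + Polynomial.C D)
    (hA : IsUnit A) (hd : Associated (B ^ 2 - 4 * A * D) d) :
    ∃ e : Module.Basis (Fin 2) R (AdjoinRoot f), Associated (Algebra.discr R e) d := by
  obtain ⟨u, rfl⟩ := hA
  set b : R := ↑u⁻¹ * B with hb
  set c : R := ↑u⁻¹ * D with hc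
  set p : Polynomial R := Polynomial.X ^ 2 + Polynomial.C b * Polynomial.X + Polynomial.C c with hp
  have hB : B = u * b := by rw [hb, Units.mul_inv_cancel_left]
  have hD : D = u * c := by rw [hc, Units.mul_inv_cancel_left]
  have hpm : p.Monic := by rw [hp]; monicity!
  have hpd : p.natDegree = 2 := by rw [hp]; compute_degree!
  have hfp : Associated p f := by
    refine ⟨Units.map (Polynomial.C : R →+* Polynomial R).toMonoidHom u, ?_⟩
    rw [hf, hp, hB, hD]
    simp
    ring
  let ψ : AdjoinRoot p ≃ₐ[R] AdjoinRoot f := AdjoinRoot.algEquivOfAssociated R p f hfp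
  let e₀ : Module.Basis (Fin 2) R (AdjoinRoot p) :=
    (AdjoinRoot.powerBasis' hpm).basis.reindex (finCongr hpd)
  have he : ∀ i, e₀ i = AdjoinRoot.root p ^ (i : ℕ) := fun i => by
    rw [Module.Basis.reindex_apply, PowerBasis.basis_eq_pow]
    rfl
  have hdisc : Algebra.discr R e₀ = b ^ 2 - 4 * c := by
    refine discr_of_sq_eq e₀ (by simp [he]) ?_
    have hr := AdjoinRoot.eval₂_root p
    rw [he, he]
    simp only [hp, Polynomial.eval₂_add, Polynomial.eval₂_mul, Polynomial.eval₂_pow,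
      Polynomial.eval₂_X, Polynomial.eval₂_C] at hr
    simp only [Fin.val_one, Fin.val_zero, pow_one, pow_zero, Algebra.smul_def, mul_one,
      AdjoinRoot.algebraMap_eq]
    linear_combination hr
  refine ⟨e₀.map ψ.toLinearEquiv, ?_⟩
  have : Algebra.discr R (e₀.map ψ.toLinearEquiv) = Algebra.discr R e₀ :=
    (Algebra.discr_eq_discr_of_algEquiv e₀ ψ).symm
  rw [this, hdisc]
  refine Associated.trans ⟨u ^ 2, ?_⟩ hd
  rw [hB, hD]
  push_cast
  ring

end QuadraticAlgebras

section DoubleCover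

variable {k : Type*}

theorem isDoubleCoverAt [CommRing k] {g h : MvPolynomial (Fin 2) k}
    {R : Type*} [CommRing R] [IsLocalRing R] [Algebra k R]
    (hg : g.IsHomogeneous 2) (hh : h.IsHomogeneous 2) {x : Fin 3 → R}
    (hx : IsUnit (aeval x (formQ₀ g h)) ∨ IsUnit (aeval x (formQ₁ g h)) ∨
      IsUnit (aeval x (formQ₂ g h))) :
    IsDoubleCoverAt (bundleForm g h) (branchForm (bundleForm g h)) x := by
  rw [IsDoubleCoverAt, fibre₂_bundleForm hg hh, branchForm_bundleForm hg hh]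
  simp only [map_sub, map_mul, map_pow, map_ofNat]
  generalize aeval x (formQ₀ g h) = q0 at *
  generalize aeval x (formQ₁ g h) = q1 at *
  generalize aeval x (formQ₂ g h) = q2 at *
  obtain ⟨α, β, hαβ, hα⟩ : ∃ α β : Fin 2 → R, IsUnit (α 0 * β 1 - α 1 * β 0) ∧
      IsUnit (eval α (binForm q0 q1 q2)) := by
    by_cases h0 : IsUnit q0
    · exact ⟨![1, 0], ![0, 1], by simp, by simpa [eval_binForm] using h0⟩
    by_cases h2 : IsUnit q2
    · exact ⟨![0, 1], ![1, 0], by simp, by simpa [eval_binForm] using h2⟩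
    -- In the remaining case `q0` and `q2` lie in the maximal ideal and `q1` is a unit, so the value
    -- `q0 + q1 + q2` at `(1, 1)` is a unit.
    refine ⟨![1, 1], ![0, 1], by simp, ?_⟩
    have h1 : IsUnit q1 := by tauto
    by_contra H
    have e : eval ![1, 1] (binForm q0 q1 q2) = q0 + q1 + q2 := by simp [eval_binForm]
    rw [e] at H
    have := IsLocalRing.nonunits_add (IsLocalRing.nonunits_add
      (a := q0 + q1 + q2) (b := -q0) H (by simpa using h0)) (b := -q2) (by simpa using h2)
    exact this (by convert h1 using 1; ring)
  refine ⟨α, β, hαβ, hα, exists_basis_adjoinRoot_quadratic (A := eval α (binForm q0 q1 q2))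
    (B := 2 * q0 * α 0 * β 0 + q1 * (α 0 * β 1 + α 1 * β 0) + 2 * q2 * α 1 * β 1)
    (D := eval β (binForm q0 q1 q2)) ?_ hα ?_⟩
  · simp only [aeval_binForm, eval_binForm, Polynomial.algebraMap_eq, map_add, map_mul, map_pow,
      map_ofNat]
    ring
  -- A linear change of coordinates multiplies the discriminant of a binary form by the square of
  -- its determinant, here a unit.
  · obtain ⟨u, hu⟩ := hαβ
    refine Associated.symm ⟨u ^ 2, ?_⟩
    push_cast
    rw [hu, eval_binForm, eval_binForm]
    ring

/-- If all three values were non-units, their reductions would give a common zero over the residue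
field, so every coordinate of `x` would reduce to zero. -/
theorem exists_isUnit_of_isCoprime [Field k] {g h : MvPolynomial (Fin 2) k}
    {R : Type*} [CommRing R] [IsLocalRing R]
    [Algebra k R] (h2 : (2 : k) ≠ 0) (H : IsCoprime (pairQuartic g h) (pairCubic g h))
    {x : Fin 3 → R} (hx : ∃ i, IsUnit (x i)) :
    IsUnit (aeval x (formQ₀ g h)) ∨ IsUnit (aeval x (formQ₁ g h)) ∨
      IsUnit (aeval x (formQ₂ g h)) := by
  by_contra! hu
  let φ : R →ₐ[k] IsLocalRing.ResidueField R := IsScalarTower.toAlgHom k R _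
  have hφ : ∀ r : R, ¬ IsUnit r → φ r = 0 := fun r hr =>
    (IsLocalRing.residue_eq_zero_iff r).2 ((IsLocalRing.mem_maximalIdeal r).2 hr)
  have key : ∀ q : MvPolynomial (Fin 3) k, ¬ IsUnit (aeval x q) →
      aeval (fun i => φ (x i)) q = 0 := fun q hq => by
    rw [← hφ _ hq, ← comp_aeval_apply]
  have := eq_zero_of_isCoprime_pair h2 H (key _ hu.1) (key _ hu.2.1) (key _ hu.2.2)
  obtain ⟨i, hi⟩ := hx
  exact (hi.map φ).ne_zero (congrFun this i)

theorem isUnit_of_isUnit_coeff [CommRing k] {g h : MvPolynomial (Fin 2) k}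
    {R : Type*} [CommRing R] [Nontrivial R] [Algebra k R]
    (hg : g.IsHomogeneous 2) (hh : h.IsHomogeneous 2) {x : Fin 3 → R} {m : Fin 2 →₀ ℕ}
    (hm : IsUnit ((fibre₂ (bundleForm g h) x).coeff m)) :
    IsUnit (aeval x (formQ₀ g h)) ∨ IsUnit (aeval x (formQ₁ g h)) ∨
      IsUnit (aeval x (formQ₂ g h)) := by
  rw [fibre₂_bundleForm hg hh] at hm
  have hd := not_imp_comm.1 (isHomogeneous_binForm _ _ _).coeff_eq_zero hm.ne_zero
  rcases eq_of_degree_eq_two m hd with rfl | rfl | rfl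
  · rw [coeff_binForm_zero] at hm
    exact Or.inl hm
  · rw [coeff_binForm_mixed] at hm
    exact Or.inr (Or.inl hm)
  · rw [coeff_binForm_one] at hm
    exact Or.inr (Or.inr hm)

end DoubleCover

/-! ### Point counts in the geometric fibres of the second projection. -/

section GeometricFibres

variable {K : Type*} [Field K]

/-- The conditions say that the form equals `(u₁ s - u₀ t) (w₁ s - w₀ t)`, so that `u` and `w` are
its zeros. They come from the quadratic formula, or from the visible factor `t` if `a = 0`. -/
theorem exists_factorization_binForm [IsAlgClosed K] (h2 : (2 : K) ≠ 0) (a b c : K)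
    (habc : ¬ (a = 0 ∧ b = 0 ∧ c = 0)) : ∃ u w : Fin 2 → K, u ≠ 0 ∧ w ≠ 0 ∧
      a = u 1 * w 1 ∧ b = -(u 0 * w 1 + u 1 * w 0) ∧ c = u 0 * w 0 := by
  by_cases ha : a = 0
  · refine ⟨![1, 0], ![c, -b], fun H => one_ne_zero (congrFun H 0), fun H => habc ?_, ?_⟩
    · exact ⟨ha, neg_eq_zero.1 (congrFun H 1), congrFun H 0⟩
    · simp [ha]
  · obtain ⟨d, hd⟩ := IsAlgClosed.exists_pow_nat_eq (b ^ 2 - 4 * a * c) (n := 2) two_pos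
    have h4 : (4 : K) ≠ 0 := by
      rw [show (4 : K) = 2 * 2 by norm_num]
      exact mul_ne_zero h2 h2
    refine ⟨![-b + d, 2 * a], ![(-b - d) / (4 * a), 1 / 2], fun H => ?_, fun H => ?_, ?_⟩
    · exact mul_ne_zero h2 ha (congrFun H 1)
    · exact one_div_ne_zero h2 (congrFun H 1)
    · simp
      refine ⟨by field_simp, ?_, ?_⟩
      · field_simp
        ring
      · field_simp
        linear_combination hd

theorem mk_eq_mk_iff_wedge {u v : Fin 2 → K} (hu : u ≠ 0) (hv : v ≠ 0) :
    Projectivization.mk K u hu = Projectivization.mk K v hv ↔ u 0 * v 1 - u 1 * v 0 = 0 := by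
  rw [Projectivization.mk_eq_mk_iff']
  constructor
  · rintro ⟨a, rfl⟩
    simp only [Pi.smul_apply, smul_eq_mul]
    ring
  · intro H
    by_cases h0 : v 0 = 0
    · have h1 : v 1 ≠ 0 := fun h1 => hv (by ext i; fin_cases i <;> assumption)
      refine ⟨u 1 / v 1, ?_⟩
      have hu0 : u 0 = 0 := by simpa [h0, h1] using H
      ext i
      fin_cases i
      · simp [h0, hu0]
      · simp [h1]
    · refine ⟨u 0 / v 0, ?_⟩
      ext i
      fin_cases i
      · simp [h0]
      · simp only [Pi.smul_apply, smul_eq_mul, Fin.mk_one]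
        field_simp
        linear_combination H

/-- The discriminant is `(u₀ w₁ - u₁ w₀)²`, which vanishes exactly when the two zeros coincide. -/
theorem ncard_zeros_binForm [IsAlgClosed K] (h2 : (2 : K) ≠ 0) {a b c : K}
    (habc : ¬ (a = 0 ∧ b = 0 ∧ c = 0)) (S : Set (Projectivization K (Fin 2 → K)))
    (hS : ∀ p, p ∈ S ↔ a * p.rep 0 ^ 2 + b * (p.rep 0 * p.rep 1) + c * p.rep 1 ^ 2 = 0) :
    (b ^ 2 - 4 * a * c = 0 → S.ncard = 1) ∧ (b ^ 2 - 4 * a * c ≠ 0 → S.ncard = 2) := by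
  obtain ⟨u, w, hu, hw, rfl, rfl, rfl⟩ := exists_factorization_binForm h2 a b c habc
  have key : S = {Projectivization.mk K u hu, Projectivization.mk K w hw} := by
    ext p
    rw [hS, Set.mem_insert_iff, Set.mem_singleton_iff]
    conv_rhs => rw [← p.mk_rep, mk_eq_mk_iff_wedge, mk_eq_mk_iff_wedge, ← mul_eq_zero]
    ring_nf
  have hdisc : (-(u 0 * w 1 + u 1 * w 0)) ^ 2 - 4 * (u 1 * w 1) * (u 0 * w 0) =
      (u 0 * w 1 - u 1 * w 0) ^ 2 := by ring
  rw [key, hdisc]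
  refine ⟨fun H => ?_, fun H => Set.ncard_pair fun e => H ?_⟩
  · rw [(mk_eq_mk_iff_wedge hu hw).2 (pow_eq_zero_iff two_ne_zero |>.1 H), Set.pair_eq_singleton,
      Set.ncard_singleton]
  · rw [(mk_eq_mk_iff_wedge hu hw).1 e, zero_pow two_ne_zero]

theorem ncard_geometricFibre [IsAlgClosed K] {k : Type*} [Field k] [Algebra k K]
    {g h : MvPolynomial (Fin 2) k} (h2 : (2 : k) ≠ 0) (hg : g.IsHomogeneous 2)
    (hh : h.IsHomogeneous 2) {x : Projectivization K (Fin 3 → K)}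
    (hx : x ∉ fullFibrePoints K (bundleForm g h)) :
    (aeval x.rep (branchForm (bundleForm g h)) = 0 →
      {p | (p, x) ∈ points K (bundleForm g h)}.ncard = 1) ∧
    (aeval x.rep (branchForm (bundleForm g h)) ≠ 0 →
      {p | (p, x) ∈ points K (bundleForm g h)}.ncard = 2) := by
  rw [mem_fullFibrePoints_iff hg hh] at hx
  rw [branchForm_bundleForm hg hh]
  simp only [map_sub, map_mul, map_pow, map_ofNat]
  refine ncard_zeros_binForm (two_ne_zero_of_algebra k K h2) hx _ fun p => ?_
  rw [← aeval_fibre₁ hg hh, aeval_eq_eval]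
  rfl

end GeometricFibres

/-! ### Nonsingularity of the branch curve when `Z` is empty. -/

section Smoothness

variable {K : Type*} [Field K] {F : Polynomial K} {g h : MvPolynomial (Fin 2) K}
variable {Ω : Type*} [Field Ω] [Algebra K Ω]

theorem aeval_derivative_of_isDetPair (H : IsDetPair F g h) (t : Ω) :
    Polynomial.aeval t F.derivative =
      2 * (t ^ 3 - aeval ![1, t] g) *
        (3 * t ^ 2 - algebraMap K Ω (g.coeff (Finsupp.single 0 1 + Finsupp.single 1 1)) -
          2 * t * algebraMap K Ω (g.coeff (Finsupp.single 1 2))) - 5 * t ^ 4 +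
      aeval ![1, t] h + t * (algebraMap K Ω (h.coeff (Finsupp.single 0 1 + Finsupp.single 1 1)) +
        2 * t * algebraMap K Ω (h.coeff (Finsupp.single 1 2))) := by
  obtain ⟨hg, hh, hF⟩ := (isDetPair_iff F g h).1 H
  have hg' := fun v : Fin 2 → Ω => congrArg (aeval v) (eq_binForm_of_isHomogeneous hg)
  have hh' := fun v : Fin 2 → Ω => congrArg (aeval v) (eq_binForm_of_isHomogeneous hh)
  rw [eq_binForm_of_isHomogeneous hg, eq_binForm_of_isHomogeneous hh, aeval_binForm,
    aeval_binForm] at hF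
  rw [hF, hg', hh', aeval_binForm, aeval_binForm]
  simp [Polynomial.algebraMap_eq, Polynomial.derivative_pow, map_ofNat]
  ring

/-- At a zero of `B` where all the partial derivatives with respect to the coordinates of the plane
and to `t` vanish, `F` has a multiple root. -/
theorem aeval_derivative_eq_zero (H : IsDetPair F g h) {t : Ω} (ht : t ≠ 0) {v : Fin 3 → Ω}
    (hv : v ≠ 0) (hM : (fibreMatrix g h ![1, t]).mulVec v = 0)
    (hq : aeval v (formQ₁ g h) + 2 * t * aeval v (formQ₂ g h) = 0) :
    Polynomial.aeval t F.derivative = 0 := by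
  rw [aeval_derivative_of_isDetPair H]
  rw [aeval_formQ₁, aeval_formQ₂] at hq
  rw [fibreMatrix_one_point] at hM
  have r0 := congrFun hM 0
  have r1 := congrFun hM 1
  have r2 := congrFun hM 2
  simp [Matrix.mulVec, dotProduct, Fin.sum_univ_three, -aeval_eq_eval] at r0 r1 r2
  generalize aeval ![1, t] g = G at *
  generalize aeval ![1, t] h = L at *
  generalize algebraMap K Ω (g.coeff (Finsupp.single 0 1 + Finsupp.single 1 1)) = g1 at *
  generalize algebraMap K Ω (g.coeff (Finsupp.single 1 2)) = g2 at *
  generalize algebraMap K Ω (h.coeff (Finsupp.single 0 1 + Finsupp.single 1 1)) = h1 at *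
  generalize algebraMap K Ω (h.coeff (Finsupp.single 1 2)) = h2 at *
  obtain ⟨y, hy⟩ : ∃ y, v 1 = y := ⟨_, rfl⟩
  -- Conceptually, `adj M` is `-t / v₂²` times `v vᵗ`, so the derivative of `det M(1, t)` is a
  -- multiple of `vᵗ M' v = Q₁ + 2 t Q₂ = 0`. The computation eliminates `v 1` by the middle row and
  -- then uses the two outer rows.
  obtain rfl : y = -(t * v 0) - t ^ 2 * v 2 := by rw [← hy]; linear_combination r1
  rw [hy] at r0 r2 hq
  have s0 : t * v 0 = (G - t ^ 3) * v 2 := by linear_combination -r0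
  have s2 : (G - t ^ 3) * v 0 = -(L - t ^ 4) * v 2 := by linear_combination r2
  have hz : v 2 ≠ 0 := fun hz => by
    have hx : v 0 = 0 := by simpa [hz, ht] using s0
    exact hv (by ext i; fin_cases i <;> simp [hx, hy, hz])
  refine (mul_eq_zero.1 (show v 2 ^ 2 * _ = 0 from ?_)).resolve_left (pow_ne_zero 2 hz)
  linear_combination t * hq + (v 0 + 6 * t ^ 2 * v 2 - 2 * (g1 + 2 * t * g2) * v 2) * s0 + v 2 * s2

theorem isNonsingular_branchForm (h2 : (2 : K) ≠ 0) (hs : F.Separable) (hF0 : F.coeff 0 ≠ 0)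
    (H : IsDetPair F g h) (hc : IsCoprime (pairQuartic g h) (pairCubic g h)) :
    IsNonsingular (branchForm (bundleForm g h)) := by
  intro v hv hb
  by_contra! hp
  have h2' := two_ne_zero_of_algebra K (AlgebraicClosure K) h2
  rw [branchForm_bundleForm H.1 H.2.1] at hb
  simp only [map_sub, map_mul, map_pow, map_ofNat] at hb
  have d0 : ∀ i, aeval v (pderiv i (formQ₀ g h)) = _ :=
    aeval_pderiv_quadForm ((isSymm_conicMatrix g h).map _) v
  have d1 : ∀ i, aeval v (pderiv i (formQ₁ g h)) = _ :=
    aeval_pderiv_quadForm ((isSymm_conicMatrix g h).map _) v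
  have d2 : ∀ i, aeval v (pderiv i (formQ₂ g h)) = _ :=
    aeval_pderiv_quadForm ((isSymm_conicMatrix g h).map _) v
  simp only [aeval_pderiv_branchForm H.1 H.2.1, d0, d1, d2] at hp
  -- The hypotheses say that the binary form at `v` is `lam (t S - s T)²`, with `(s : t)` as double
  -- root. There the gradient of `Q₁² - 4 Q₀ Q₂` is `-4 lam (s² ∇Q₀ + s t ∇Q₁ + t² ∇Q₂) = -8 lam
  -- M(s, t) v`.
  have hM : ∀ s t lam : AlgebraicClosure K, lam ≠ 0 → aeval v (formQ₀ g h) = lam * t ^ 2 →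
      aeval v (formQ₁ g h) = -2 * lam * s * t → aeval v (formQ₂ g h) = lam * s ^ 2 →
      (fibreMatrix g h ![s, t]).mulVec v = 0 := fun s t lam hlam e0 e1 e2 => by
    ext i
    have h8 : -(2 ^ 3 * lam) ≠ 0 := neg_ne_zero.2 (mul_ne_zero (pow_ne_zero 3 h2') hlam)
    refine (mul_eq_zero.1 (show -(2 ^ 3 * lam) * _ = 0 from ?_)).resolve_left h8
    have := hp i
    rw [e0, e1, e2] at this
    rw [fibreMatrix_eq H.1 H.2.1, Matrix.add_mulVec, Matrix.add_mulVec, Matrix.smul_mulVec,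
      Matrix.smul_mulVec, Matrix.smul_mulVec]
    simp only [Pi.add_apply, Pi.smul_apply, smul_eq_mul, Matrix.cons_val_zero, Matrix.cons_val_one]
    linear_combination this
  -- If `Q₂ = 0`, the double root is `(0 : 1)`, where `M` is invertible. Otherwise it is `(1 : t)`
  -- with `t = -Q₁ / (2 Q₂)`.
  by_cases hq2 : aeval v (formQ₂ g h) = 0
  · have hq1 : aeval v (formQ₁ g h) = 0 := by simpa [hq2] using hb
    have hq0 : aeval v (formQ₀ g h) ≠ 0 := fun hq0 =>
      hv (eq_zero_of_isCoprime_pair h2 hc hq0 hq1 hq2)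
    have := Matrix.exists_mulVec_eq_zero_iff.1
      ⟨v, hv, hM 0 1 _ hq0 (by ring) (by rw [hq1]; ring) (by rw [hq2]; ring)⟩
    rw [det_fibreMatrix_of_zero g h rfl] at this
    simp at this
  · obtain ⟨t, ht⟩ : ∃ t, aeval v (formQ₁ g h) + 2 * t * aeval v (formQ₂ g h) = 0 :=
      ⟨-aeval v (formQ₁ g h) / (2 * aeval v (formQ₂ g h)), by field_simp; ring⟩
    have hMt := hM 1 t _ hq2
      (mul_left_cancel₀ (mul_ne_zero (pow_ne_zero 2 h2') hq2) (by
        linear_combination -hb + (aeval v (formQ₁ g h) - 2 * t * aeval v (formQ₂ g h)) * ht))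
      (by linear_combination ht) (by ring)
    have hFt := Matrix.exists_mulVec_eq_zero_iff.1 ⟨v, hv, hMt⟩
    rw [det_fibreMatrix H, neg_eq_zero] at hFt
    have ht0 : t ≠ 0 := by
      rintro rfl
      rw [← Polynomial.coeff_zero_eq_aeval_zero', map_eq_zero] at hFt
      exact hF0 hFt
    exact hs.aeval_derivative_ne_zero hFt (aeval_derivative_eq_zero H ht0 hv hMt ht)

end Smoothness

/-! ### The genericity condition. -/

section Generic

variable {k : Type*} [Field k]

/-- The resultant of the quartic and the cubic polynomial attached to the forms `g`, `h` with
coefficients `a, b, c` and `a', b', c'`. -/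
noncomputable def pairResultant {R : Type*} [CommRing R] (a b c a' b' c' : R) : R :=
  Polynomial.resultant (fullQuartic a c a' c') (fullCubic b c b' c') 4 3

/-- The degrees 4 and 3 are fixed in the definition, so the resultant commutes with every ring
homomorphism. -/
theorem map_pairResultant {R S : Type*} [CommRing R] [CommRing S] (φ : R →+* S)
    (a b c a' b' c' : R) : φ (pairResultant a b c a' b' c') =
      pairResultant (φ a) (φ b) (φ c) (φ a') (φ b') (φ c') := by
  rw [pairResultant, ← Polynomial.resultant_map_map, map_fullQuartic, map_fullCubic, pairResultant]

theorem pairResultant_eq_zero_iff (a b c a' b' c' : k) : pairResultant a b c a' b' c' = 0 ↔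
    ¬ IsCoprime (fullQuartic a c a' c') (fullCubic b c b' c') := by
  have := Polynomial.resultant_eq_zero_iff (f := fullQuartic a c a' c') (g := fullCubic b c b' c')
  rw [natDegree_fullQuartic, natDegree_fullCubic] at this
  exact this.trans (and_iff_right (Or.inl (monic_fullQuartic _ _ _ _).ne_zero))

/-- `pairResultant` for the pair `(g, h)` with `g(1, 0) = a 0`, where the other `a i` are the
coefficients of `F`. -/
noncomputable def fullResultant (k : Type*) [Field k] {R : Type*} [CommRing R] [Algebra k R]
    (a : Fin 6 → R) : R :=
  let g₂ := -algebraMap k R 2⁻¹ * (a 5 + 1)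
  let g₁ := algebraMap k R 2⁻¹ * (g₂ ^ 2 - a 4)
  pairResultant (a 0) g₁ g₂ (a 1 - 2 * a 0 * g₁) (a 2 - g₁ ^ 2 - 2 * a 0 * g₂)
    (a 3 - 2 * g₁ * g₂ + 2 * a 0)

theorem map_fullResultant {R S : Type*} [CommRing R] [Algebra k R] [CommRing S] [Algebra k S]
    (φ : R →ₐ[k] S) (a : Fin 6 → R) :
    φ (fullResultant k a) = fullResultant k fun i => φ (a i) := by
  refine (map_pairResultant (φ : R →+* S) _ _ _ _ _ _).trans ?_
  simp only [fullResultant, RingHom.coe_coe, map_sub, map_mul, map_add, map_neg, map_pow, map_one,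
    map_ofNat, AlgHom.commutes]

theorem isCoprime_pair_of_fullResultant_ne_zero {K : Type*} [Field K] [Algebra k K]
    (F : Polynomial K) (c : K)
    (H : fullResultant k (Function.update (fun i : Fin 6 => F.coeff i) 0 c) ≠ 0) :
    IsCoprime (pairQuartic (detPair F c).1 (detPair F c).2)
      (pairCubic (detPair F c).1 (detPair F c).2) := by
  have e2 : -(2 : K)⁻¹ * (F.coeff 5 + 1) = -(F.coeff 5 + 1) / 2 := by ring
  have e1 : ∀ y : K, (2 : K)⁻¹ * y = y / 2 := fun y => by ring
  have e3 : algebraMap k K 2⁻¹ = 2⁻¹ := by rw [map_inv₀, map_ofNat]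
  have h1 : Function.update (fun i : Fin 6 => F.coeff i) 0 c =
      ![c, F.coeff 1, F.coeff 2, F.coeff 3, F.coeff 4, F.coeff 5] := by
    funext i
    fin_cases i <;> rfl
  by_contra hc
  apply H
  simp only [pairQuartic, pairCubic, detPair, coeff_binForm_zero, coeff_binForm_mixed,
    coeff_binForm_one] at hc
  rw [h1]
  simp only [fullResultant, e3, Matrix.cons_val, e2, e1]
  exact (pairResultant_eq_zero_iff _ _ _ _ _ _).2 hc

theorem exists_even_odd_decomposition (p : MvPolynomial (Fin 6) k) :
    ∃ E O : MvPolynomial (Fin 6) k,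
      p = aeval (Function.update X 0 (X 0 ^ 2) : Fin 6 → MvPolynomial (Fin 6) k) E +
        X 0 * aeval (Function.update X 0 (X 0 ^ 2) : Fin 6 → MvPolynomial (Fin 6) k) O := by
  induction p using MvPolynomial.induction_on with
  | C a => exact ⟨C a, 0, by simp [algebraMap_eq]⟩
  | add p q hp hq =>
    obtain ⟨E, O, hp⟩ := hp
    obtain ⟨E', O', hq⟩ := hq
    refine ⟨E + E', O + O', ?_⟩
    conv_lhs => rw [hp, hq]
    simp only [map_add]
    ring
  | mul_X p i hp =>
    obtain ⟨E, O, hp⟩ := hp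
    by_cases hi : i = 0
    · subst hi
      refine ⟨X 0 * O, E, ?_⟩
      conv_lhs => rw [hp]
      simp only [map_mul, aeval_X, Function.update_self]
      ring
    · refine ⟨E * X i, O * X i, ?_⟩
      conv_lhs => rw [hp]
      simp only [map_mul, aeval_X, Function.update_of_ne hi]
      ring

/-- The resultant involves `c`, while `Δ` may involve only `a₀ = c²`. Writing `p = E(c²) + c O(c²)`,
the product of `p` with its conjugate under `c ↦ -c` is `E² - c² O²`. -/
theorem exists_norm_of_sqrt (p : MvPolynomial (Fin 6) k) : ∃ Δ : MvPolynomial (Fin 6) k,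
    aeval (Function.update X 0 (X 0 ^ 2) : Fin 6 → MvPolynomial (Fin 6) k) Δ =
      p * aeval (Function.update X 0 (-X 0) : Fin 6 → MvPolynomial (Fin 6) k) p := by
  obtain ⟨E, O, hp⟩ := exists_even_odd_decomposition p
  have key : ∀ q : MvPolynomial (Fin 6) k,
      aeval (Function.update X 0 (-X 0) : Fin 6 → MvPolynomial (Fin 6) k)
        (aeval (Function.update X 0 (X 0 ^ 2) : Fin 6 → MvPolynomial (Fin 6) k) q) =
      aeval (Function.update X 0 (X 0 ^ 2) : Fin 6 → MvPolynomial (Fin 6) k) q := fun q => by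
    rw [← AlgHom.comp_apply, comp_aeval]
    congr 2
    funext i
    by_cases hi : i = 0
    · subst hi
      simp
    · simp [Function.update_of_ne hi]
  refine ⟨E ^ 2 - X 0 * O ^ 2, ?_⟩
  rw [hp]
  simp only [map_add, map_mul, map_sub, map_pow, aeval_X, key, Function.update_self]
  ring

theorem aeval_of_norm {Δ p : MvPolynomial (Fin 6) k}
    (hΔ : aeval (Function.update X 0 (X 0 ^ 2) : Fin 6 → MvPolynomial (Fin 6) k) Δ =
      p * aeval (Function.update X 0 (-X 0) : Fin 6 → MvPolynomial (Fin 6) k) p)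
    {K : Type*} [Field K] [Algebra k K] (a : Fin 6 → K) (c : K) (hc : a 0 = c ^ 2) :
    aeval a Δ = aeval (Function.update a 0 c) p * aeval (Function.update a 0 (-c)) p := by
  have key : ∀ (y : MvPolynomial (Fin 6) k) (d : K), aeval (Function.update a 0 c) y = d →
      ∀ q : MvPolynomial (Fin 6) k, aeval (Function.update a 0 c)
        (aeval (Function.update X 0 y : Fin 6 → MvPolynomial (Fin 6) k) q) =
      aeval (Function.update a 0 d) q := fun y d hd q => by
    rw [← AlgHom.comp_apply, comp_aeval]
    congr 2
    funext i
    by_cases hi : i = 0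
    · subst hi
      simpa using hd
    · simp [Function.update_of_ne hi]
  have := congrArg (aeval (Function.update a 0 c)) hΔ
  rwa [map_mul, key _ (a 0) (by simp [hc]), key _ (-c) (by simp), Function.update_eq_self] at this

/-- The values are chosen so that `g₁ = 0`, the quartic becomes `(T² - T)² + 4` and the cubic
becomes `T³`. These are coprime because 4 is a unit. -/
theorem fullResultant_ne_zero (h2 : (2 : k) ≠ 0) :
    fullResultant k (![0, 1, 0, 0, 4⁻¹, 0] : Fin 6 → k) ≠ 0 := by
  have h4 : (4 : k) ≠ 0 := by
    rw [show (4 : k) = 2 * 2 by norm_num]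
    exact mul_ne_zero h2 h2
  have e4 : (-2⁻¹ : k) ^ 2 = 4⁻¹ := by
    rw [show (4 : k) = 2 ^ 2 by norm_num, neg_sq, inv_pow]
  have e1 : 2 * (-2⁻¹ : k) = -1 := by field_simp
  have hq : fullQuartic (0 : k) (-2⁻¹) 1 0 =
      Polynomial.C 4 + Polynomial.X * (Polynomial.X * (Polynomial.X - 1) ^ 2) := by
    simp only [fullQuartic, e1, mul_zero, mul_one, map_zero, map_neg, map_one]
    ring
  have hc : fullCubic (0 : k) (-2⁻¹) 0 0 = Polynomial.X ^ 3 := by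
    simp only [fullCubic, e1, mul_zero, map_zero, sub_zero, neg_add_cancel, zero_mul, add_zero]
  have hcop : IsCoprime (fullQuartic (0 : k) (-2⁻¹) 1 0) (fullCubic (0 : k) (-2⁻¹) 0 0) := by
    rw [hq, hc]
    exact IsCoprime.pow_right (IsCoprime.add_mul_left_left
      (isCoprime_one_left.of_isCoprime_of_dvd_left
        ((isUnit_iff_ne_zero.2 h4).map Polynomial.C).dvd) _)
  have e : fullResultant k (![0, 1, 0, 0, 4⁻¹, 0] : Fin 6 → k) =
      pairResultant 0 0 (-2⁻¹) 1 0 0 := by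
    simp [fullResultant, e4]
  rw [e, Ne, pairResultant_eq_zero_iff, not_not]
  exact hcop

theorem detPair_eq_of_isDetPair (h2 : (2 : k) ≠ 0) {F : Polynomial k} (hF : F.Monic)
    (hd : F.natDegree = 6) {g h : MvPolynomial (Fin 2) k} {c : k} (H : IsDetPair F g h)
    (hc : eval ![1, 0] g = c) : (g, h) = detPair F c := by
  obtain ⟨d, -, e⟩ := (isDetPair_iff_eq_detPair h2 hF hd g h).1 H
  have : c = d := by rw [← hc, ← eval_detPair F d, ← e]
  rw [this, e]

theorem isNonsingular_branchForm_of_fullResultant_ne_zero (h2 : (2 : k) ≠ 0) {K : Type*} [Field K]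
    [Algebra k K] {F : Polynomial K} {c : K} (hF : F.Monic) (hd : F.natDegree = 6)
    (hs : F.Separable) (hF0 : F.coeff 0 ≠ 0)
    (H : fullResultant k (Function.update (fun i : Fin 6 => F.coeff i) 0 c) ≠ 0)
    {g h : MvPolynomial (Fin 2) K} (hgh : IsDetPair F g h) (hc : eval ![1, 0] g = c) :
    IsNonsingular (branchForm (bundleForm g h)) := by
  have h2' := two_ne_zero_of_algebra k K h2
  have hcop := isCoprime_pair_of_fullResultant_ne_zero F c H
  rw [← detPair_eq_of_isDetPair h2' hF hd hgh hc] at hcop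
  exact isNonsingular_branchForm h2' hs hF0 hgh hcop

theorem exists_norm_fullResultant (h2 : (2 : k) ≠ 0) : ∃ Δ : MvPolynomial (Fin 6) k, Δ ≠ 0 ∧
    aeval (Function.update X 0 (X 0 ^ 2) : Fin 6 → MvPolynomial (Fin 6) k) Δ =
      fullResultant k (X : Fin 6 → MvPolynomial (Fin 6) k) *
        aeval (Function.update X 0 (-X 0) : Fin 6 → MvPolynomial (Fin 6) k)
          (fullResultant k (X : Fin 6 → MvPolynomial (Fin 6) k)) := by
  obtain ⟨Δ, hΔ⟩ := exists_norm_of_sqrt (fullResultant k (X : Fin 6 → MvPolynomial (Fin 6) k))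
  refine ⟨Δ, ?_, hΔ⟩
  rintro rfl
  -- At `c = 0` the two conjugate factors coincide. The value `a₀ = 0` is allowed here, since only
  -- `Δ ≠ 0` as a polynomial is at stake.
  have := aeval_of_norm hΔ (![0, 1, 0, 0, 4⁻¹, 0] : Fin 6 → k) 0 (by simp)
  rw [map_zero, neg_zero, map_fullResultant] at this
  simp only [aeval_X] at this
  rw [Function.update_eq_self_iff.2 (by rfl)] at this
  exact mul_ne_zero (fullResultant_ne_zero h2) (fullResultant_ne_zero h2) this.symm

theorem fullResultant_ne_zero_of_norm {Δ : MvPolynomial (Fin 6) k}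
    (hΔ : aeval (Function.update X 0 (X 0 ^ 2) : Fin 6 → MvPolynomial (Fin 6) k) Δ =
      fullResultant k (X : Fin 6 → MvPolynomial (Fin 6) k) *
        aeval (Function.update X 0 (-X 0) : Fin 6 → MvPolynomial (Fin 6) k)
          (fullResultant k (X : Fin 6 → MvPolynomial (Fin 6) k)))
    {K : Type*} [Field K] [Algebra k K] (a : Fin 6 → K) (c : K) (hc : a 0 = c ^ 2)
    (ha : aeval a Δ ≠ 0) : fullResultant k (Function.update a 0 c) ≠ 0 := by
  rw [aeval_of_norm hΔ a c hc, map_fullResultant] at ha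
  simpa only [aeval_X] using left_ne_zero_of_mul ha

end Generic

end ConicBundle

open ConicBundle in
theorem mainTheorem8 (k : Type*) [Field k] (hchar : (2 : k) ≠ 0) :
    -- the claims about an individual polynomial `F` and a square root `c` of `F(0)`
    (∀ (F : Polynomial k) (c : k), F.Monic → F.natDegree = 6 → F.Separable →
      c ≠ 0 → F.coeff 0 = c ^ 2 →
      -- exactly two pairs `(g, h)`, one for each of the two values `c`, `-c` of `g(1, 0)`
      ({p : MvPolynomial (Fin 2) k × MvPolynomial (Fin 2) k | IsDetPair F p.1 p.2}.ncard = 2 ∧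
        (∀ g h, IsDetPair F g h →
          MvPolynomial.eval ![1, 0] g = c ∨ MvPolynomial.eval ![1, 0] g = -c) ∧
        (∃! p : MvPolynomial (Fin 2) k × MvPolynomial (Fin 2) k,
          IsDetPair F p.1 p.2 ∧ MvPolynomial.eval ![1, 0] p.1 = c) ∧
        (∃! p : MvPolynomial (Fin 2) k × MvPolynomial (Fin 2) k,
          IsDetPair F p.1 p.2 ∧ MvPolynomial.eval ![1, 0] p.1 = -c)) ∧
      (∀ g h : MvPolynomial (Fin 2) k, IsDetPair F g h → MvPolynomial.eval ![1, 0] g = c →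
        -- a hypersurface of bidegree `(2, 2)`
        (bundleForm g h ≠ 0 ∧ IsBihomogeneous (bundleForm g h) 2 2) ∧
        -- the generic fibre of `pr₁` is a nonsingular conic
        ((fibre₁ (bundleForm g h) ![(1 : RatFunc k), RatFunc.X]).IsHomogeneous 2 ∧
          fibre₁ (bundleForm g h) ![(1 : RatFunc k), RatFunc.X] ≠ 0 ∧
          IsNonsingular (fibre₁ (bundleForm g h) ![(1 : RatFunc k), RatFunc.X])) ∧
        -- all fibres are conics, and the degenerate ones lie over the roots of `F`
        (∀ (K : Type*) [Field K] [Algebra k K],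
          (∀ p : Projectivization K (Fin 2 → K),
            (fibre₁ (bundleForm g h) p.rep).IsHomogeneous 2 ∧
              fibre₁ (bundleForm g h) p.rep ≠ 0) ∧
          degeneratePoints K (bundleForm g h) = affinePoint '' F.rootSet K) ∧
        -- splitting of the six degenerate fibres, and the operation of the Galois group
        (∀ (l : Type*) [Field l] [Algebra k l]
            [Polynomial.IsSplittingField k l (F.comp (Polynomial.X ^ 2))],
          IsGalois k l ∧
          (degeneratePoints l (bundleForm g h)).ncard = 6 ∧
          (∀ p ∈ degeneratePoints l (bundleForm g h), ∃ l₁ l₂ : MvPolynomial (Fin 3) l,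
            l₁.IsHomogeneous 1 ∧ l₂.IsHomogeneous 1 ∧ ¬ Associated l₁ l₂ ∧
              fibre₁ (bundleForm g h) p.rep = l₁ * l₂) ∧
          (∀ (Ω : Type*) [Field Ω] [Algebra k Ω] [Algebra l Ω] [IsScalarTower k l Ω],
            Set.BijOn (transport (algebraMap l Ω))
              (degenerateComponents l (bundleForm g h))
              (degenerateComponents Ω (bundleForm g h))) ∧
          ∃ e : l → Projectivization l (Fin 2 → l) × Associates (MvPolynomial (Fin 3) l),
            Set.BijOn e ((F.comp (Polynomial.X ^ 2)).rootSet l)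
              (degenerateComponents l (bundleForm g h)) ∧
            ∀ r ∈ (F.comp (Polynomial.X ^ 2)).rootSet l,
              (e r).1 = affinePoint (r ^ 2) ∧
              ∀ σ : l ≃ₐ[k] l, e (σ r) = transport (σ : l →+* l) (e r)) ∧
        -- the quartic curve `C`
        ((branchForm (bundleForm g h)).IsHomogeneous 4 ∧ branchForm (bundleForm g h) ≠ 0) ∧
        -- `pr₂` is a double cover with branch curve `C` where it is quasi-finite
        (∀ (R : Type*) [CommRing R] [IsLocalRing R] [Algebra k R] (x : Fin 3 → R),
          (∃ i, IsUnit (x i)) →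
          ((∃ m, IsUnit ((fibre₂ (bundleForm g h) x).coeff m)) ∨
            IsNonsingular (branchForm (bundleForm g h))) →
          IsDoubleCoverAt (bundleForm g h) (branchForm (bundleForm g h)) x) ∧
        -- there are only finitely many exceptional points, and `C` is singular there
        (∀ (K : Type*) [Field K] [Algebra k K],
          (fullFibrePoints K (bundleForm g h)).Finite ∧
          ∀ x ∈ fullFibrePoints K (bundleForm g h),
            MvPolynomial.aeval x.rep (branchForm (bundleForm g h)) = 0 ∧
            ∀ i, MvPolynomial.aeval x.rep
              (MvPolynomial.pderiv i (branchForm (bundleForm g h))) = 0) ∧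
        -- the other geometric fibres of `pr₂` have one point over `C` and two points elsewhere
        (∀ (K : Type*) [Field K] [IsAlgClosed K] [Algebra k K],
          ∀ x : Projectivization K (Fin 3 → K), x ∉ fullFibrePoints K (bundleForm g h) →
            (MvPolynomial.aeval x.rep (branchForm (bundleForm g h)) = 0 →
              {p | (p, x) ∈ points K (bundleForm g h)}.ncard = 1) ∧
            (MvPolynomial.aeval x.rep (branchForm (bundleForm g h)) ≠ 0 →
              {p | (p, x) ∈ points K (bundleForm g h)}.ncard = 2)))) ∧
    -- for generic `F`, the curve `C` is nonsingular
    (∃ Δ : MvPolynomial (Fin 6) k, Δ ≠ 0 ∧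
      ∀ (K : Type*) [Field K] [Algebra k K] (F : Polynomial K) (c : K),
        F.Monic → F.natDegree = 6 → F.Separable → c ≠ 0 → F.coeff 0 = c ^ 2 →
        MvPolynomial.aeval (fun i : Fin 6 => F.coeff i) Δ ≠ 0 →
        ∀ g h : MvPolynomial (Fin 2) K, IsDetPair F g h → MvPolynomial.eval ![1, 0] g = c →
          IsNonsingular (branchForm (bundleForm g h))) := by
  refine ⟨fun F c hF hd hs hc hFc => ⟨detPair_claims hchar hF hd hc hFc, fun g h H _ => ?_⟩, ?_⟩
  · have hg := H.1
    have hh := H.2.1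
    have hF0 : F.coeff 0 ≠ 0 := by
      rw [hFc]
      exact pow_ne_zero 2 hc
    have hone : (![1, RatFunc.X] : Fin 2 → RatFunc k) ≠ 0 := fun e => one_ne_zero (congrFun e 0)
    refine ⟨⟨fun e => ?_, isBihomogeneous_bundleForm hg hh⟩, ⟨?_, ?_, ?_⟩, ?_, ?_, ?_, ?_, ?_, ?_⟩
    -- If the bihomogeneous form were zero, its generic fibre would be zero too.
    · refine fibre₁_ne_zero hchar g h hone ?_
      rw [e, fibre₁, map_zero]
    · rw [fibre₁_bundleForm]
      exact isHomogeneous_quadForm _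
    · exact fibre₁_ne_zero hchar g h hone
    · exact isNonsingular_genericFibre hchar hF.ne_zero H
    · intro K _ _
      refine ⟨fun p => ⟨?_, fibre₁_ne_zero hchar g h p.rep_nonzero⟩,
        degeneratePoints_eq hchar hF.ne_zero H⟩
      rw [fibre₁_bundleForm]
      exact isHomogeneous_quadForm _
    · intro l _ _ _
      obtain ⟨h6, hlines⟩ := degenerateFibres_claims (l := l) hchar hs hF0 H
      refine ⟨isGalois_splittingField hchar hs hF0, h6.trans hd, hlines, ?_, component g,
        bijOn_component_of_splittingField l l hchar hF.ne_zero hF0 H, fun r _ => ⟨rfl, ?_⟩⟩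
      · intro Ω _ _ _ _
        exact bijOn_transport hchar hF.ne_zero hF0 H
      · intro σ
        exact (transport_component (g := g) (σ : l →ₐ[k] l) r).symm
    · exact ⟨isHomogeneous_branchForm hg hh, branchForm_ne_zero hg hh⟩
    · intro R _ _ _ x hx hcase
      refine isDoubleCoverAt hg hh ?_
      rcases hcase with ⟨m, hm⟩ | hns
      · exact isUnit_of_isUnit_coeff hg hh hm
      · exact exists_isUnit_of_isCoprime hchar
          (isCoprime_pair_of_isNonsingular hchar hg hh hns) hx
    · intro K _ _
      exact ⟨finite_fullFibrePoints hchar hg hh, fun x hx =>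
        singular_of_mem_fullFibrePoints hg hh hx⟩
    · intro K _ _ _ x hx
      exact ncard_geometricFibre hchar hg hh hx
  · obtain ⟨Δ, hΔ0, hΔ⟩ := exists_norm_fullResultant hchar
    refine ⟨Δ, hΔ0, fun K _ _ F c hF hd hs hc hFc ha g h H hgc => ?_⟩
    refine isNonsingular_branchForm_of_fullResultant_ne_zero hchar hF hd hs ?_
      (fullResultant_ne_zero_of_norm hΔ _ c hFc ha) H hgc
    rw [hFc]
    exact pow_ne_zero 2 hc
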